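/- Let $0=r_0<r_1<r_2<\cdots$ be a strictly increasing sequence of real numbers with $\lim_{m\to\infty} r_m=\infty$ that satisfies the Müntz condition $\sum_{i\ge 1} 1/r_i=\infty$, let $0<a<1$, and write $\Lambda_m=(r_0,\dots,r_m)$ and $E(\Lambda_m)=\operatorname{span}(1,t^{r_1},\dots,t^{r_m})$. The Chebyshev–Bernstein basis of $E(\Lambda_m)$ over $[a,1]$ is the unique basis $(B_0^m,\dots,B_m^m)$ of $E(\Lambda_m)$ with $\sum_k B_k^m=1$ such that, for $k=0,\dots,m$, $B_k^m$ has $k$ zeros at $a$ and $m-k$ zeros at $1$, counted with multiplicity. For a function $Q$ with values in some $\mathbb R^d$ and with components in $E(\Lambda_m)$, its control points $\eta_i(Q,\Lambda_m,[a,1])$, $0\le i\le m$, are the unique points of $\mathbb R^d$ with $Q(t)=\sum_{i=0}^m B_i^m(t)\,\eta_i(Q,\Lambda_m,[a,1])$ on $[a,1]$. Let $P$ be a function with values in $\mathbb R^s$ and components in $E(\Lambda_n)$. Then the control points of $P$ (for every $m\ge n$) and of $t^{r_1}$ (for every $m\ge1$) exist and are unique, $\eta_i(t^{r_1},\Lambda_m,[a,1])\in[a^{r_1},1]$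 for all $m\ge 1$ and $0\le i\le m$, and $$\lim_{m\to\infty}\ \max_{0\le i\le m}\Big\|P\big(\eta_i(t^{r_1},\Lambda_m,[a,1])^{1/r_1}\big)-\eta_i(P,\Lambda_m,[a,1])\Big\|_\infty=0 ,$$ where $\|\cdot\|_\infty$ is the maximum norm on $\mathbb R^s$. -/

import Mathlib

open Filter Topology Set

/-- The Müntz space `E(Λ_n) = span (t ^ r 0, t ^ r 1, …, t ^ r n)` of real functions.
Only the values of its elements at points `t > 0` are ever used. -/
noncomputable def muntzSpace (r : ℕ → ℝ) (n : ℕ) : Submodule ℝ (ℝ → ℝ) :=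
  Submodule.span ℝ (Set.range fun (k : Fin (n + 1)) (t : ℝ) => t ^ r k)

/-- `f` has (at least) `k` zeros at `x`, counted with multiplicity. -/
def VanishesToOrder (f : ℝ → ℝ) (k : ℕ) (x : ℝ) : Prop :=
  ∀ j < k, iteratedDeriv j f x = 0

/-- `(B 0, …, B n)` is the Chebyshev-Bernstein basis of the Müntz space `E(Λ_n)` over `[a, b]`:
a basis of that space, normalized to have sum one, such that `B k` has `k` zeros at `a` and
`n - k` zeros at `b`. -/
structure IsChebyshevBernsteinBasis (r : ℕ → ℝ) (n : ℕ) (a b : ℝ)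
    (B : Fin (n + 1) → ℝ → ℝ) : Prop where
  linearIndependent : LinearIndependent ℝ B
  span_eq : Submodule.span ℝ (Set.range B) = muntzSpace r n
  sum_eq_one : ∀ t ∈ Set.Icc a b, ∑ k, B k t = 1
  zeros_left : ∀ k : Fin (n + 1), VanishesToOrder (B k) k a
  zeros_right : ∀ k : Fin (n + 1), VanishesToOrder (B k) (n - k) b

/-- `(p 0, …, p n)` are the Chebyshev-Bézier control points over `[a, b]` of the curve `P`,
viewed as an element of the Müntz space `E(Λ_n)`. -/
def IsControlPolygon {V : Type*} [AddCommGroup V] [Module ℝ V] (r : ℕ → ℝ) (n : ℕ) (a b : ℝ)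
    (P : ℝ → V) (p : Fin (n + 1) → V) : Prop :=
  ∃ B : Fin (n + 1) → ℝ → ℝ, IsChebyshevBernsteinBasis r n a b B ∧
    ∀ t ∈ Set.Icc a b, P t = ∑ k, B k t • p k

open Classical in
/-- The control points `η_i(P, Λ_n, [a, b])`, `i = 0, …, n`. -/
noncomputable def controlPoint {V : Type*} [AddCommGroup V] [Module ℝ V] (r : ℕ → ℝ) (n : ℕ)
    (a b : ℝ) (P : ℝ → V) : Fin (n + 1) → V :=
  if h : ∃ p : Fin (n + 1) → V, IsControlPolygon r n a b P p then h.choose else 0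

/-! The control points are known exactly. Let `q / p` be the rational function with `deg p ≤ i`,
`deg q ≤ m - i`, `q(0) = 1` that interpolates `a ^ z` at `r 0, …, r m`, in the sense `a ^ z p = q`
at these nodes. On `∑ c_j t ^ r j` the functional `∑ c_j q(r j) = ∑ c_j a ^ r j p(r j)` sees only
derivatives of order at most `m - i` at `1`, and equally only derivatives of order at most `i` at
`a`. Hence it kills every Bernstein function except the `i`-th, and `q(0) = 1` normalizes it. So the
`i`-th control point of `t ^ r j` is `q(r j)` with `q = padeNum a r i (m - i)`.

Three facts about these numerators carry the proof. Consecutive ones differ by a positive multiple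
of `z` times a numerator for shifted nodes (`padeNum_sub_padeNum`). This makes the control points of
`t ^ r j` monotone in `i`, and Lipschitz with constant `r j / r 1` in those of `t ^ r 1`
(`padeNum_eval_lipschitz`). Corner cutting writes them as convex combinations, with weights
independent of `j`, of the products `∏ (1 - r j / r s)`, which are the control points over `[0, 1]`
(`exists_padeNum_eq_convex_combination`). The Bernstein functions are nonnegative on `[a, 1]`
(`muntzCombination_nonneg`).

The limit is then a Korovkin-type argument. Under the Müntz condition the products over `[0, 1]` are
asymptotically powers `x ^ r j` of a common `x`. Approximating `x ^ (2 r 1)` from the Müntz space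
therefore bounds the squares of the control points of `t ^ r 1`, and Jensen's inequality carries the
bound over to `[a, 1]`. It follows that the variance of the control points of `t ^ r 1` under the
weights `B_k(t)` tends to zero uniformly in `t` (`eventually_variance_le`). Take `t` with `t ^ r 1`
equal to the `i`-th control point. Then `t ^ r j` is the mean of the control points of `t ^ r j`,
and the Lipschitz bound puts it close to the `i`-th one. Linearity extends this to `P`. -/

/-! ### Zeros of exponential polynomials and signs of interpolating coefficients -/

open Polynomial in
theorem Polynomial.degree_derivative_add_C_mul_lt {p : ℝ[X]} {n : ℕ} (hp : p.degree < n) (c : ℝ) :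
    (derivative p + C c * p).degree < n := by
  rw [degree_lt_iff_coeff_zero] at hp ⊢
  intro m hm
  simp [coeff_derivative, hp m hm, hp (m + 1) (by omega)]

open Polynomial in
theorem Polynomial.degree_derivative_lt_of_degree_lt_succ {p : ℝ[X]} {n : ℕ}
    (hp : p.degree < (n + 1 : ℕ)) : (derivative p).degree < n := by
  rw [degree_lt_iff_coeff_zero] at hp ⊢
  intro m hm
  simp [coeff_derivative, hp (m + 1) (by omega)]

/-- Rolle's theorem for a finite set of zeros. -/
theorem exists_finset_deriv_zeros {g g' : ℝ → ℝ} (hg : ∀ x, HasDerivAt g (g' x) x) {Z : Finset ℝ}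
    (hZ : ∀ z ∈ Z, g z = 0) :
    ∃ Z' : Finset ℝ, Z.card ≤ Z'.card + 1 ∧ ∀ z ∈ Z', g' z = 0 := by
  classical
  have key : ∀ w : ℝ × ℝ, ∃ c, w.1 ∈ Z → w.2 ∈ Z → w.1 < w.2 → w.1 < c ∧ c < w.2 ∧ g' c = 0 := by
    intro w
    by_cases h : w.1 ∈ Z ∧ w.2 ∈ Z ∧ w.1 < w.2
    · obtain ⟨c, hc, hc'⟩ := exists_hasDerivAt_eq_zero h.2.2
        (fun x _ => (hg x).continuousAt.continuousWithinAt)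
        ((hZ _ h.1).trans (hZ _ h.2.1).symm) (fun x _ => hg x)
      exact ⟨c, fun _ _ _ => ⟨hc.1, hc.2, hc'⟩⟩
    · exact ⟨0, fun h1 h2 h3 => (h ⟨h1, h2, h3⟩).elim⟩
  choose c hc using key
  refine ⟨((Z ×ˢ Z).filter fun w => w.1 < w.2).image c, ?_, ?_⟩
  · refine Finset.card_le_of_interleaved fun x hx y hy hxy _ => ?_
    exact ⟨c (x, y), Finset.mem_image_of_mem _ (by simp [hx, hy, hxy]),
      (hc (x, y) hx hy hxy).1, (hc (x, y) hx hy hxy).2.1⟩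
  · intro z hz
    simp only [Finset.mem_image, Finset.mem_filter, Finset.mem_product] at hz
    obtain ⟨w, ⟨⟨h1, h2⟩, h3⟩, rfl⟩ := hz
    exact (hc w h1 h2 h3).2.2

theorem hasDerivAt_exp_mul_eval (s x : ℝ) (p : Polynomial ℝ) :
    HasDerivAt (fun z => Real.exp (s * z) * p.eval z)
      (Real.exp (s * x) * (Polynomial.derivative p + Polynomial.C s * p).eval x) x := by
  have h1 : HasDerivAt (fun z => Real.exp (s * z)) (Real.exp (s * x) * s) x := by
    simpa using ((hasDerivAt_id x).const_mul s).exp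
  refine (h1.fun_mul (p.hasDerivAt x)).congr_deriv ?_
  simp only [Polynomial.eval_add, Polynomial.eval_mul, Polynomial.eval_C]
  ring

open Polynomial in
/-- An exponential polynomial `∑ exp (s z) p_s(z)` with `∑ (deg p_s + 1)` distinct real zeros
is zero. -/
theorem exp_polynomial_eq_zero (n : ℕ) : ∀ (S : Finset ℝ) (d : ℝ → ℕ) (p : ℝ → ℝ[X])
    (Z : Finset ℝ), ∑ s ∈ S, d s = n → (∀ s ∈ S, (p s).degree < d s) →
    (∀ z ∈ Z, ∑ s ∈ S, Real.exp (s * z) * (p s).eval z = 0) → n ≤ Z.card →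
    ∀ s ∈ S, p s = 0 := by
  induction n with
  | zero =>
    intro S d p Z hd hp _ _ s hs
    have := hp s hs
    rw [(Finset.sum_eq_zero_iff.1 hd) s hs] at this
    simpa using this
  | succ n ih =>
    intro S d p Z hd hp hZ hn
    classical
    obtain ⟨s₀, hs₀, hds₀⟩ : ∃ s ∈ S, d s ≠ 0 := by
      by_contra! h
      rw [Finset.sum_eq_zero h] at hd
      omega
    obtain ⟨e, he⟩ := Nat.exists_eq_succ_of_ne_zero hds₀
    -- Multiplying by `exp (-s₀ z)` makes the `s₀` term a plain polynomial. Differentiation lowers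
    -- its degree, keeps the other degree bounds, and costs one zero by Rolle.
    have hg : ∀ x, HasDerivAt (fun z => ∑ s ∈ S, Real.exp ((s - s₀) * z) * (p s).eval z)
        (∑ s ∈ S, Real.exp ((s - s₀) * x) * (derivative (p s) + C (s - s₀) * p s).eval x) x :=
      fun x => HasDerivAt.fun_sum fun s _ => hasDerivAt_exp_mul_eval _ _ _
    have hfac : ∀ (q : ℝ → ℝ[X]) (z : ℝ), ∑ s ∈ S, Real.exp ((s - s₀) * z) * (q s).eval z =
        Real.exp (-s₀ * z) * ∑ s ∈ S, Real.exp (s * z) * (q s).eval z := by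
      intro q z
      rw [Finset.mul_sum]
      refine Finset.sum_congr rfl fun s _ => ?_
      rw [← mul_assoc, ← Real.exp_add]
      ring_nf
    obtain ⟨Z', hZ'c, hZ'⟩ := exists_finset_deriv_zeros hg (Z := Z) (fun z hz => by
      rw [hfac, hZ z hz, mul_zero])
    have hder := ih S (Function.update d s₀ e)
      (fun s => derivative (p s) + C (s - s₀) * p s) Z' (by
        rw [Finset.sum_update_of_mem hs₀]
        rw [← Finset.add_sum_erase S d hs₀, he] at hd
        rw [Finset.sdiff_singleton_eq_erase]
        omega)
      (by
        intro s hs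
        by_cases h : s = s₀
        · subst h
          have := hp s hs
          rw [he] at this
          simpa using degree_derivative_lt_of_degree_lt_succ this
        · rw [Function.update_of_ne h]
          exact degree_derivative_add_C_mul_lt (hp s hs) _)
      (by
        intro z hz
        have := hZ' z hz
        rw [hfac (fun s => derivative (p s) + C (s - s₀) * p s)] at this
        exact (mul_eq_zero.1 this).resolve_left (Real.exp_ne_zero _))
      (by omega)
    -- A nonzero polynomial cannot be a nonzero multiple of its derivative. Only a constant at `s₀`
    -- can survive, and one zero removes it.
    have hne : ∀ s ∈ S, s ≠ s₀ → p s = 0 := by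
      intro s hs hss
      by_contra hps
      have h1 : derivative (p s) = C (-(s - s₀)) * p s := by
        rw [C_neg]
        linear_combination hder s hs
      have h2 := degree_derivative_lt hps
      rw [h1, degree_C_mul (neg_ne_zero.2 (sub_ne_zero.2 hss))] at h2
      exact lt_irrefl _ h2
    intro s hs
    by_cases h : s = s₀
    · subst h
      have h1 : derivative (p s) = 0 := by simpa using hder s hs
      have h2 := eq_C_of_derivative_eq_zero h1
      obtain ⟨z, hz⟩ : Z.Nonempty := Finset.card_pos.1 (by omega)
      have h3 := hZ z hz
      rw [Finset.sum_eq_single_of_mem s hs (fun t ht hts => by simp [hne t ht hts]), h2] at h3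
      rw [h2]
      simpa using h3
    · exact hne s hs h

open Polynomial in
/-- Uniqueness of interpolation by `a ^ z p(z) + q(z)`. -/
theorem rpow_mul_eval_add_eval_eq_zero {a : ℝ} (ha0 : 0 < a) (ha1 : a < 1) {k l : ℕ} {p q : ℝ[X]}
    (hp : p.degree < k) (hq : q.degree < l) {Z : Finset ℝ}
    (hZ : ∀ z ∈ Z, a ^ z * p.eval z + q.eval z = 0) (hc : k + l ≤ Z.card) : p = 0 ∧ q = 0 := by
  have hlog : Real.log a ≠ 0 := (Real.log_neg ha0 ha1).ne
  have := exp_polynomial_eq_zero (k + l) {Real.log a, 0} (fun s => if s = 0 then l else k)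
    (fun s => if s = 0 then q else p) Z (by simp [hlog]) (by simp [hlog, hp, hq]) (by
      intro z hz
      simpa [hlog, Real.rpow_def_of_pos ha0] using hZ z hz) hc
  simpa [hlog] using this

open Polynomial in
/-- Sign of the leading coefficient of the polynomial interpolating `A exp (-b z)`. -/
theorem coeff_sign_of_exp_sub_eval_zeros {b : ℝ} (hb : 0 < b) (l : ℕ) : ∀ {A : ℝ} (_ : 0 < A)
    {q : ℝ[X]} (_ : q.degree < (l + 1 : ℕ)) {Z : Finset ℝ}
    (_ : ∀ z ∈ Z, A * Real.exp (-b * z) - q.eval z = 0) (_ : l + 1 ≤ Z.card),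
    0 < (-1) ^ l * q.coeff l := by
  induction l with
  | zero =>
    intro A hA q hq Z hZ hc
    obtain ⟨z, hz⟩ : Z.Nonempty := Finset.card_pos.1 (by omega)
    have h := hZ z hz
    rw [eq_C_of_degree_le_zero (p := q) (by
      rw [← Nat.WithBot.lt_one_iff_le_zero]; simpa using hq), eval_C] at h
    have := mul_pos hA (Real.exp_pos (-b * z))
    simp
    linarith
  | succ l ih =>
    intro A hA q hq Z hZ hc
    -- Up to sign the derivative has the same shape, with `b A` for `A` and `-q'` for `q`. This
    -- accounts for the alternating sign.
    have hg : ∀ x, HasDerivAt (fun z => A * Real.exp (-b * z) - q.eval z)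
        (-(b * A * Real.exp (-b * x) - (-derivative q).eval x)) x := by
      intro x
      have h1 : HasDerivAt (fun z => Real.exp (-b * z)) (Real.exp (-b * x) * (-b)) x := by
        simpa using ((hasDerivAt_id x).const_mul (-b)).exp
      refine ((h1.const_mul A).fun_sub (q.hasDerivAt x)).congr_deriv ?_
      rw [eval_neg]
      ring
    obtain ⟨Z', hc', hZ'⟩ := exists_finset_deriv_zeros hg hZ
    have := ih (mul_pos hb hA) (q := -derivative q)
      (by rw [degree_neg]; exact degree_derivative_lt_of_degree_lt_succ hq)
      (fun z hz => neg_eq_zero.1 (hZ' z hz)) (by omega)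
    simp only [coeff_neg, coeff_derivative] at this
    have hl : (0 : ℝ) < l + 1 := by positivity
    rw [pow_succ]
    have h3 : (-1) ^ l * -(q.coeff (l + 1) * (l + 1)) =
        ((-1) ^ l * -1 * q.coeff (l + 1)) * (l + 1) := by
      ring
    rw [h3] at this
    exact pos_of_mul_pos_left this hl.le

-- Each differentiation costs one zero by Rolle, lowers the degree of `p`, and multiplies the top
-- coefficient of `q` by `c > 0`. Once `p` is gone, division by `exp (c z)` leaves a decaying
-- exponential minus a polynomial.
open Polynomial in
theorem coeff_sign_of_exp_sub_sub_zeros {c d : ℝ} (hc : 0 < c) (hd : 0 < d) (hdc : d < c)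
    (l k : ℕ) : ∀ {A : ℝ} (_ : 0 < A) {p q : ℝ[X]} (_ : p.degree < k)
    (_ : q.degree < (l + 1 : ℕ)) {Z : Finset ℝ}
    (_ : ∀ z ∈ Z, A * Real.exp (d * z) - p.eval z - Real.exp (c * z) * q.eval z = 0)
    (_ : k + l + 1 ≤ Z.card), 0 < (-1) ^ l * q.coeff l := by
  induction k with
  | zero =>
    intro A hA p q hp hq Z hZ hcard
    have hp0 : p = 0 := by simpa using hp
    refine coeff_sign_of_exp_sub_eval_zeros (sub_pos.2 hdc) l hA hq (Z := Z) (fun z hz => ?_)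
      (by omega)
    have h := hZ z hz
    rw [hp0, eval_zero, sub_zero] at h
    have h2 : A * Real.exp (-(c - d) * z) - q.eval z = Real.exp (-(c * z)) *
        (A * Real.exp (d * z) - Real.exp (c * z) * q.eval z) := by
      rw [mul_sub, mul_left_comm, ← Real.exp_add, ← mul_assoc, ← Real.exp_add, neg_add_cancel,
        Real.exp_zero, one_mul]
      ring_nf
    rw [h2, h, mul_zero]
  | succ k ih =>
    intro A hA p q hp hq Z hZ hcard
    have hg : ∀ x, HasDerivAt
        (fun z => A * Real.exp (d * z) - p.eval z - Real.exp (c * z) * q.eval z)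
        (A * d * Real.exp (d * x) - (derivative p).eval x -
          Real.exp (c * x) * (derivative q + C c * q).eval x) x := by
      intro x
      have h1 : HasDerivAt (fun z => Real.exp (d * z)) (Real.exp (d * x) * d) x := by
        simpa using ((hasDerivAt_id x).const_mul d).exp
      refine (((h1.const_mul A).fun_sub (p.hasDerivAt x)).fun_sub
        (hasDerivAt_exp_mul_eval c x q)).congr_deriv ?_
      ring
    obtain ⟨Z', hc', hZ'⟩ := exists_finset_deriv_zeros hg hZ
    have := ih (mul_pos hA hd) (degree_derivative_lt_of_degree_lt_succ hp)
      (degree_derivative_add_C_mul_lt hq c) hZ' (by omega)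
    rw [coeff_add, coeff_derivative, coeff_C_mul,
      (degree_lt_iff_coeff_zero q (l + 1)).1 hq (l + 1) le_rfl, zero_mul, zero_add,
      mul_left_comm] at this
    exact pos_of_mul_pos_right this hc.le

open Polynomial in
/-- Sign of the leading coefficient of `q` if `a ^ z p(z) + q(z)` interpolates `x ^ z`. -/
theorem coeff_sign_of_interpolates_rpow {a x : ℝ} (ha0 : 0 < a) (hax : a < x) (hx1 : x < 1)
    {k l : ℕ} {p q : ℝ[X]} (hp : p.degree < k) (hq : q.degree < (l + 1 : ℕ)) {Z : Finset ℝ}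
    (hZ : ∀ z ∈ Z, a ^ z * p.eval z + q.eval z = x ^ z) (hc : k + l + 1 ≤ Z.card) :
    0 < (-1) ^ l * q.coeff l := by
  have hx0 := ha0.trans hax
  have h1 := Real.log_lt_log ha0 hax
  have h2 := Real.log_neg hx0 hx1
  -- Multiplication by `a ^ (-z)` turns the interpolation error into `(x / a) ^ z - p - a ^ (-z) q`.
  refine coeff_sign_of_exp_sub_sub_zeros (c := -Real.log a) (d := Real.log x - Real.log a)
    (by linarith) (by linarith) (by linarith) l k one_pos hp hq (Z := Z) (fun z hz => ?_) hc
  have h := hZ z hz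
  rw [Real.rpow_def_of_pos ha0, Real.rpow_def_of_pos hx0] at h
  have e1 : Real.exp ((Real.log x - Real.log a) * z) =
      Real.exp (-Real.log a * z) * Real.exp (Real.log x * z) := by
    rw [← Real.exp_add]; ring_nf
  have e2 : Real.exp (-Real.log a * z) * Real.exp (Real.log a * z) = 1 := by
    rw [← Real.exp_add]; ring_nf; simp
  rw [e1, ← h]
  linear_combination p.eval z * e2

/-! ### Interpolation by `a ^ z p(z) + q(z)` -/

open Polynomial in
/-- The linear map sending `(p, q)` to the values of `a ^ z p(z) + q(z)` at the nodes. -/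
noncomputable def interpolationMap (a : ℝ) (k l : ℕ) {n : ℕ} (ν : Fin n → ℝ) :
    (degreeLT ℝ k × degreeLT ℝ l) →ₗ[ℝ] (Fin n → ℝ) :=
  LinearMap.pi fun j =>
    ((a ^ ν j) • (Polynomial.leval (ν j)).comp ((degreeLT ℝ k).subtype)).comp
        (LinearMap.fst ℝ _ _) +
      ((Polynomial.leval (ν j)).comp ((degreeLT ℝ l).subtype)).comp (LinearMap.snd ℝ _ _)

theorem interpolationMap_apply (a : ℝ) (k l : ℕ) {n : ℕ} (ν : Fin n → ℝ)
    (w : Polynomial.degreeLT ℝ k × Polynomial.degreeLT ℝ l) (j : Fin n) :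
    interpolationMap a k l ν w j =
      a ^ ν j * (w.1 : Polynomial ℝ).eval (ν j) + (w.2 : Polynomial ℝ).eval (ν j) := by
  simp [interpolationMap, Polynomial.leval_apply]

theorem finrank_degreeLT_prod (k l : ℕ) :
    Module.finrank ℝ (Polynomial.degreeLT ℝ k × Polynomial.degreeLT ℝ l) = k + l := by
  rw [Module.finrank_prod, (Polynomial.degreeLTEquiv ℝ k).finrank_eq,
    (Polynomial.degreeLTEquiv ℝ l).finrank_eq]
  simp

theorem interpolationMap_injective {a : ℝ} (ha0 : 0 < a) (ha1 : a < 1) {k l n : ℕ}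
    {ν : Fin n → ℝ} (hν : Function.Injective ν) (hn : k + l ≤ n) :
    Function.Injective (interpolationMap a k l ν) := by
  classical
  rw [injective_iff_map_eq_zero]
  rintro ⟨p, q⟩ h
  have := rpow_mul_eval_add_eval_eq_zero ha0 ha1 (Polynomial.mem_degreeLT.1 p.2)
    (Polynomial.mem_degreeLT.1 q.2) (Z := Finset.univ.image ν) (by
      intro z hz
      obtain ⟨j, -, rfl⟩ := Finset.mem_image.1 hz
      have := congrFun h j
      rwa [interpolationMap_apply] at this)
    (by rwa [Finset.card_image_of_injective _ hν, Finset.card_univ, Fintype.card_fin])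
  exact Prod.ext (Subtype.ext this.1) (Subtype.ext this.2)

/-- Interpolation by `a ^ z p(z) + q(z)`. -/
noncomputable def interpolationEquiv {a : ℝ} (ha0 : 0 < a) (ha1 : a < 1) {k l n : ℕ}
    {ν : Fin n → ℝ} (hν : Function.Injective ν) (hn : k + l = n) :
    (Polynomial.degreeLT ℝ k × Polynomial.degreeLT ℝ l) ≃ₗ[ℝ] (Fin n → ℝ) :=
  LinearEquiv.ofInjectiveOfFinrankEq (interpolationMap a k l ν)
    (interpolationMap_injective ha0 ha1 hν hn.le) (by
      rw [finrank_degreeLT_prod, hn, Module.finrank_fin_fun])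

open Polynomial in
theorem exists_interpolates {a : ℝ} (ha0 : 0 < a) (ha1 : a < 1) {k l n : ℕ}
    {ν : Fin n → ℝ} (hν : Function.Injective ν) (hn : k + l = n) (v : Fin n → ℝ) :
    ∃ p q : ℝ[X], p.degree < k ∧ q.degree < l ∧
      ∀ j, a ^ ν j * p.eval (ν j) + q.eval (ν j) = v j := by
  let w := (interpolationEquiv ha0 ha1 hν hn).symm v
  refine ⟨w.1, w.2, mem_degreeLT.1 w.1.2, mem_degreeLT.1 w.2.2, fun j => ?_⟩
  rw [← interpolationMap_apply]
  exact congrFun ((interpolationEquiv ha0 ha1 hν hn).apply_symm_apply v) j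

open Polynomial in
/-- The leading coefficient of `q` as a functional of the values of `a ^ z p(z) + q(z)`. -/
theorem exists_weights_coeff {a : ℝ} (ha0 : 0 < a) (ha1 : a < 1) {k l n : ℕ}
    {ν : Fin n → ℝ} (hν : Function.Injective ν) (hn : k + (l + 1) = n) :
    ∃ w : Fin n → ℝ, (∀ p q : ℝ[X], p.degree < k → q.degree < (l + 1 : ℕ) →
        q.coeff l = ∑ j, w j * (a ^ ν j * p.eval (ν j) + q.eval (ν j))) ∧
      ∀ x, a < x → x < 1 → 0 < (-1) ^ l * ∑ j, w j * x ^ ν j := by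
  classical
  let e := interpolationEquiv ha0 ha1 hν hn
  let φ : (Fin n → ℝ) →ₗ[ℝ] ℝ := ((lcoeff ℝ l).comp (degreeLT ℝ (l + 1)).subtype).comp
    ((LinearMap.snd ℝ _ _).comp e.symm.toLinearMap)
  have hφ : ∀ v, φ v = ∑ j, φ (Pi.single j 1) * v j := by
    intro v
    rw [LinearMap.pi_apply_eq_sum_univ φ v]
    refine Finset.sum_congr rfl fun j _ => ?_
    rw [smul_eq_mul, mul_comm]
    congr 2
    ext i
    simp [Pi.single_apply, eq_comm]
  have h1 : ∀ p q : ℝ[X], p.degree < k → q.degree < (l + 1 : ℕ) →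
      q.coeff l = ∑ j, φ (Pi.single j 1) * (a ^ ν j * p.eval (ν j) + q.eval (ν j)) := by
    intro p q hp hq
    let w : degreeLT ℝ k × degreeLT ℝ (l + 1) := (⟨p, mem_degreeLT.2 hp⟩, ⟨q, mem_degreeLT.2 hq⟩)
    have h2 := hφ (e w)
    have h3 : φ (e w) = q.coeff l := by simp [φ, w]
    rw [← h3, h2]
    refine Finset.sum_congr rfl fun j _ => ?_
    rw [← interpolationMap_apply a k (l + 1) ν w j]
    rfl
  refine ⟨fun j => φ (Pi.single j 1), h1, fun x hax hx1 => ?_⟩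
  obtain ⟨p, q, hp, hq, hpq⟩ := exists_interpolates ha0 ha1 hν hn (fun j => x ^ ν j)
  have h2 := h1 p q hp hq
  simp only [hpq] at h2
  rw [← h2]
  refine coeff_sign_of_interpolates_rpow ha0 hax hx1 hp hq (Z := Finset.univ.image ν) ?_ ?_
  · intro z hz
    obtain ⟨j, -, rfl⟩ := Finset.mem_image.1 hz
    exact hpq j
  · rw [Finset.card_image_of_injective _ hν, Finset.card_univ, Fintype.card_fin]
    omega

/-! ### Rational interpolants of `a ^ z` -/

open Polynomial in
/-- `q / p` interpolates `a ^ z` at `ρ 0, …, ρ (k + l)`, where `p` has degree at most `k` and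
`q` has degree at most `l`, and `q 0 = 1`. -/
structure IsPadePair (a : ℝ) (ρ : ℕ → ℝ) (k l : ℕ) (p q : ℝ[X]) : Prop where
  degree_den : p.degree < (k + 1 : ℕ)
  degree_num : q.degree < (l + 1 : ℕ)
  eval_zero : q.eval 0 = 1
  eval_eq : ∀ j ≤ k + l, a ^ ρ j * p.eval (ρ j) = q.eval (ρ j)

/-- The numerator of the rational interpolant of `a ^ z` at `ρ 0, …, ρ (k + l)`. -/
noncomputable def padeNum (a : ℝ) (ρ : ℕ → ℝ) (k l : ℕ) : Polynomial ℝ :=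
  Classical.epsilon fun q => ∃ p, IsPadePair a ρ k l p q

open Polynomial in
theorem degree_divX_lt {p : ℝ[X]} {n : ℕ} (hp : p.degree < (n + 1 : ℕ)) : p.divX.degree < n := by
  rw [degree_lt_iff_coeff_zero] at hp ⊢
  intro m hm
  rw [coeff_divX]
  exact hp _ (by omega)

open Polynomial in
theorem eval_divX (p : ℝ[X]) (z : ℝ) : p.eval z = z * p.divX.eval z + p.eval 0 := by
  conv_lhs => rw [← X_mul_divX_add p]
  simp [coeff_zero_eq_eval_zero]

open Polynomial in
theorem Polynomial.degree_C_mul_lt (c : ℝ) {f : ℝ[X]} {n : ℕ} (hf : f.degree < n) :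
    (C c * f).degree < n := by
  rw [degree_lt_iff_coeff_zero] at hf ⊢
  intro m hm
  simp [hf m hm]

theorem Polynomial.degree_sub_lt_of_lt {p q : Polynomial ℝ} {n : WithBot ℕ} (hp : p.degree < n)
    (hq : q.degree < n) : (p - q).degree < n :=
  (degree_sub_le p q).trans_lt (max_lt hp hq)

section

variable {a : ℝ} {ρ : ℕ → ℝ}

theorem strictMono_shift (hρ : StrictMono ρ) : StrictMono fun j => ρ (j + 1) - ρ 1 :=
  fun i j hij => sub_lt_sub_right (hρ (by omega : i + 1 < j + 1)) _

-- Since `ρ 0 = 0`, both polynomials vanish at `0`. Dividing by `z` leaves `k + l` coefficients and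
-- `k + l` nodes. This makes the normalization at `0` possible and the normalized numerator unique.
open Polynomial in
theorem pade_eq_zero (ha0 : 0 < a) (ha1 : a < 1) (h0 : ρ 0 = 0) (hρ : StrictMono ρ) {k l : ℕ}
    {p q : ℝ[X]} (hp : p.degree < (k + 1 : ℕ)) (hq : q.degree < (l + 1 : ℕ))
    (h : ∀ j ≤ k + l, a ^ ρ j * p.eval (ρ j) = q.eval (ρ j)) (hq0 : q.eval 0 = 0) :
    p = 0 ∧ q = 0 := by
  classical
  have hp0 : p.eval 0 = 0 := by
    have := h 0 (by omega)
    rw [h0] at this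
    simpa [hq0] using this
  have key := rpow_mul_eval_add_eval_eq_zero ha0 ha1 (degree_divX_lt hp) (q := -q.divX) (l := l)
    (by rw [degree_neg]; exact degree_divX_lt hq) (Z := (Finset.Icc 1 (k + l)).image ρ) (by
      intro z hz
      obtain ⟨j, hj, rfl⟩ := Finset.mem_image.1 hz
      rw [Finset.mem_Icc] at hj
      have hj0 : ρ j ≠ 0 := by
        rw [← h0]
        exact (hρ (by omega : 0 < j)).ne'
      have h1 := h j hj.2
      rw [eval_divX p, eval_divX q, hp0, hq0] at h1
      refine mul_left_cancel₀ hj0 ?_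
      rw [eval_neg]
      linear_combination h1)
    (by rw [Finset.card_image_of_injective _ hρ.injective]; simp)
  constructor
  · rw [← X_mul_divX_add p, key.1, coeff_zero_eq_eval_zero, hp0]
    simp
  · rw [← X_mul_divX_add q, neg_eq_zero.1 key.2, coeff_zero_eq_eval_zero, hq0]
    simp

open Polynomial in
theorem exists_isPadePair (ha0 : 0 < a) (ha1 : a < 1) (h0 : ρ 0 = 0) (hρ : StrictMono ρ)
    (k l : ℕ) : ∃ q p, IsPadePair a ρ k l p q := by
  -- There are `k + l + 2` coefficients and only `k + l + 1` linear conditions.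
  have hker : LinearMap.ker (interpolationMap a (k + 1) (l + 1)
      (fun j : Fin (k + l + 1) => ρ j)) ≠ ⊥ := by
    refine LinearMap.ker_ne_bot_of_finrank_lt ?_
    rw [finrank_degreeLT_prod, Module.finrank_fin_fun]
    omega
  obtain ⟨⟨p, q⟩, hpq, hne⟩ := (Submodule.ne_bot_iff _).1 hker
  have hrel : ∀ j ≤ k + l, a ^ ρ j * (p : ℝ[X]).eval (ρ j) = (-(q : ℝ[X])).eval (ρ j) := by
    intro j hj
    have := congrFun (LinearMap.mem_ker.1 hpq) ⟨j, by omega⟩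
    rw [interpolationMap_apply] at this
    simp only [Pi.zero_apply] at this
    rw [eval_neg]
    linarith
  have hp := mem_degreeLT.1 p.2
  have hq := mem_degreeLT.1 q.2
  rw [← degree_neg] at hq
  have hz : (-(q : ℝ[X])).eval 0 ≠ 0 := by
    intro hz
    have := pade_eq_zero ha0 ha1 h0 hρ hp hq hrel hz
    exact hne (Prod.ext (Subtype.ext this.1) (Subtype.ext (neg_eq_zero.1 this.2)))
  refine ⟨C ((-(q : ℝ[X])).eval 0)⁻¹ * -(q : ℝ[X]), C ((-(q : ℝ[X])).eval 0)⁻¹ * p, ?_, ?_, ?_, ?_⟩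
  · rwa [degree_C_mul (inv_ne_zero hz)]
  · rwa [degree_C_mul (inv_ne_zero hz)]
  · rw [eval_mul, eval_C, inv_mul_cancel₀ hz]
  · intro j hj
    rw [eval_mul, eval_mul, eval_C, ← hrel j hj]
    ring

open Polynomial in
theorem exists_isPadePair_padeNum (ha0 : 0 < a) (ha1 : a < 1) (h0 : ρ 0 = 0) (hρ : StrictMono ρ)
    (k l : ℕ) : ∃ p, IsPadePair a ρ k l p (padeNum a ρ k l) :=
  Classical.epsilon_spec (exists_isPadePair ha0 ha1 h0 hρ k l)

-- Numerators are identified below by checking their interpolation conditions and comparing values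
-- at `0`.
open Polynomial in
theorem eq_C_mul_padeNum (ha0 : 0 < a) (ha1 : a < 1) (h0 : ρ 0 = 0) (hρ : StrictMono ρ) {k l : ℕ}
    {p q : ℝ[X]} (hp : p.degree < (k + 1 : ℕ)) (hq : q.degree < (l + 1 : ℕ))
    (h : ∀ j ≤ k + l, a ^ ρ j * p.eval (ρ j) = q.eval (ρ j)) :
    q = C (q.eval 0) * padeNum a ρ k l := by
  obtain ⟨p', h'⟩ := exists_isPadePair_padeNum ha0 ha1 h0 hρ k l
  refine sub_eq_zero.1 (pade_eq_zero ha0 ha1 h0 hρ (p := p - C (q.eval 0) * p')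
    (degree_sub_lt_of_lt hp (degree_C_mul_lt _ h'.degree_den))
    (degree_sub_lt_of_lt hq (degree_C_mul_lt _ h'.degree_num)) ?_ ?_).2
  · intro j hj
    simp only [eval_sub, eval_mul, eval_C]
    rw [← h j hj, ← h'.eval_eq j hj]
    ring
  · simp [h'.eval_zero]

-- With one coefficient fewer, the interpolation problem has only the zero solution, against `q(0) =
-- 1`. So the denominators have exact degrees and form a triangular family.
open Polynomial in
theorem IsPadePair.coeff_den_ne_zero (ha0 : 0 < a) (ha1 : a < 1) (hρ : StrictMono ρ) {k l : ℕ}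
    {p q : ℝ[X]} (h : IsPadePair a ρ k l p q) : p.coeff k ≠ 0 := by
  classical
  intro hk
  have hp : p.degree < k := by
    rw [degree_lt_iff_coeff_zero]
    intro m hm
    rcases hm.eq_or_lt with rfl | hm
    · exact hk
    · exact (degree_lt_iff_coeff_zero p _).1 h.degree_den m hm
  have := (rpow_mul_eval_add_eval_eq_zero ha0 ha1 hp (q := -q) (l := l + 1)
    (by rw [degree_neg]; exact h.degree_num) (Z := (Finset.range (k + l + 1)).image ρ) (by
      intro z hz
      obtain ⟨j, hj, rfl⟩ := Finset.mem_image.1 hz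
      rw [h.eval_eq j (by simp at hj; omega), eval_neg]
      ring) (by rw [Finset.card_image_of_injective _ hρ.injective]; simp; omega)).2
  have h1 := h.eval_zero
  rw [neg_eq_zero.1 this] at h1
  simp at h1

theorem integral_rpow_sub_one {z : ℝ} (hz : 0 < z) :
    ∫ x in a..1, x ^ (z - 1) = (1 - a ^ z) / z := by
  rw [integral_rpow (Or.inl (by linarith))]
  simp

-- Write `p = 1 + z p̂` and `q = 1 + z q̂`. At the positive nodes `a ^ z p̂ - q̂ = (1 - a ^ z) / z`,
-- which is the integral of `x ^ (z - 1)` over `[a, 1]`. The top coefficient of `-q̂` is therefore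
-- an integral of coefficients for `x ^ z`, divided by `x`, and their sign is known for `a < x < 1`.
open Polynomial in
theorem padeNum_coeff_sign (ha0 : 0 < a) (ha1 : a < 1) (h0 : ρ 0 = 0) (hρ : StrictMono ρ)
    (k l : ℕ) : 0 < (-1) ^ l * (padeNum a ρ k l).coeff l := by
  obtain ⟨p, h⟩ := exists_isPadePair_padeNum ha0 ha1 h0 hρ k l
  set q := padeNum a ρ k l
  have hp0 : p.eval 0 = 1 := by
    have := h.eval_eq 0 (by omega)
    rw [h0] at this
    simpa [h.eval_zero] using this
  cases l with
  | zero => simp [coeff_zero_eq_eval_zero, h.eval_zero]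
  | succ l =>
    have hpos : ∀ j : ℕ, 0 < ρ (j + 1) := by
      intro j
      rw [← h0]
      exact hρ (by omega)
    obtain ⟨w, hw, hw'⟩ := exists_weights_coeff ha0 ha1 (k := k) (l := l) (n := k + (l + 1))
      (ν := fun j => ρ (j + 1)) (fun i j hij => by
        have := hρ.injective hij
        exact Fin.ext (by omega)) rfl
    have h1 := hw p.divX (-q.divX) (degree_divX_lt h.degree_den)
      (by rw [degree_neg]; exact degree_divX_lt h.degree_num)
    have h2 : ∀ j : Fin (k + (l + 1)), a ^ ρ (j + 1) * p.divX.eval (ρ (j + 1)) +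
        (-q.divX).eval (ρ (j + 1)) = ∫ x in a..1, x ^ (ρ (j + 1) - 1) := by
      intro j
      have h3 := h.eval_eq (j + 1) (by omega)
      rw [eval_divX p, eval_divX q, hp0, h.eval_zero] at h3
      rw [integral_rpow_sub_one (hpos j), eq_div_iff (hpos j).ne', eval_neg]
      linear_combination h3
    simp only [h2] at h1
    have hint : ∀ j : Fin (k + (l + 1)), IntervalIntegrable (fun x => x ^ (ρ (j + 1) - 1))
        MeasureTheory.volume a 1 := fun j =>
      intervalIntegral.intervalIntegrable_rpow' (by linarith [hpos j])
    have h4 : (-1) ^ l * (-q.divX).coeff l =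
        ∫ x in a..1, (-1) ^ l * ∑ j, w j * x ^ (ρ (j + 1) - 1) := by
      rw [h1, intervalIntegral.integral_const_mul, intervalIntegral.integral_finsetSum]
      · simp_rw [intervalIntegral.integral_const_mul]
      · exact fun j _ => (hint j).const_mul _
    have h5 : 0 < ∫ x in a..1, (-1) ^ l * ∑ j, w j * x ^ (ρ (j + 1) - 1) := by
      refine intervalIntegral.intervalIntegral_pos_of_pos_on ?_ ?_ ha1
      · refine IntervalIntegrable.const_mul ?_ _
        have := IntervalIntegrable.sum (μ := MeasureTheory.volume) (a := a) (b := 1) Finset.univ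
          (f := fun (j : Fin (k + (l + 1))) x => w j * x ^ (ρ (j + 1) - 1))
          (fun j _ => (hint j).const_mul _)
        rwa [Finset.sum_fn] at this
      · intro x hx
        have hx0 : 0 < x := ha0.trans hx.1
        have h6 : (-1) ^ l * ∑ j, w j * x ^ (ρ (j + 1) - 1) =
            ((-1) ^ l * ∑ j : Fin (k + (l + 1)), w j * x ^ ρ (j + 1)) / x := by
          rw [mul_div_assoc, Finset.sum_div]
          congr 1
          refine Finset.sum_congr rfl fun j _ => ?_
          rw [Real.rpow_sub_one hx0.ne', mul_div_assoc]
        rw [h6]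
        exact div_pos (hw' x hx.1 hx.2) hx0
    rw [← h4, coeff_neg, coeff_divX] at h5
    rw [pow_succ]
    linarith

open Polynomial in
/-- The difference of consecutive numerators is a multiple of a numerator for the shifted nodes. -/
theorem padeNum_sub_padeNum (ha0 : 0 < a) (ha1 : a < 1) (h0 : ρ 0 = 0) (hρ : StrictMono ρ)
    (k l : ℕ) : ∃ κ > 0, padeNum a ρ (k + 1) l - padeNum a ρ k (l + 1) =
      X * (C κ * (padeNum a (fun j => ρ (j + 1) - ρ 1) k l).comp (X - C (ρ 1))) := by
  obtain ⟨p₁, h₁⟩ := exists_isPadePair_padeNum ha0 ha1 h0 hρ (k + 1) l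
  obtain ⟨p₂, h₂⟩ := exists_isPadePair_padeNum ha0 ha1 h0 hρ k (l + 1)
  have h0' : (fun j => ρ (j + 1) - ρ 1) 0 = 0 := by simp
  have hρ' := strictMono_shift hρ
  have hlead := padeNum_coeff_sign ha0 ha1 h0' hρ' k l
  have hlead₂ := padeNum_coeff_sign ha0 ha1 h0 hρ k (l + 1)
  obtain ⟨p', h'⟩ := exists_isPadePair_padeNum ha0 ha1 h0' hρ' k l
  -- Both pairs satisfy the conditions at `ρ 0, …, ρ (k + l + 1)`, and their difference vanishes at
  -- `0`. Dividing it by `z` and translating by `ρ 1` gives a pair for the shifted nodes, with `a ^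
  -- ρ 1` absorbed by the denominator.
  have heq := eq_C_mul_padeNum ha0 ha1 h0' hρ' (k := k) (l := l)
    (p := C (a ^ ρ 1) * (p₁ - p₂).divX.comp (X + C (ρ 1)))
    (q := (padeNum a ρ (k + 1) l - padeNum a ρ k (l + 1)).divX.comp (X + C (ρ 1)))
  set q₁ := padeNum a ρ (k + 1) l
  set q₂ := padeNum a ρ k (l + 1)
  set q' := padeNum a (fun j => ρ (j + 1) - ρ 1) k l
  have hq0 : (q₁ - q₂).eval 0 = 0 := by simp [h₁.eval_zero, h₂.eval_zero]
  have hp0 : (p₁ - p₂).eval 0 = 0 := by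
    have e₁ := h₁.eval_eq 0 (by omega)
    have e₂ := h₂.eval_eq 0 (by omega)
    rw [h0, h₁.eval_zero] at e₁
    rw [h0, h₂.eval_zero] at e₂
    simp at e₁ e₂ ⊢
    linarith
  have hdp : (p₁ - p₂).degree < (k + 1 + 1 : ℕ) := degree_sub_lt_of_lt h₁.degree_den
    (h₂.degree_den.trans (by exact_mod_cast Nat.lt_succ_self _))
  have hdq : (q₁ - q₂).degree < (l + 1 + 1 : ℕ) := degree_sub_lt_of_lt
    (h₁.degree_num.trans (by exact_mod_cast Nat.lt_succ_self _)) h₂.degree_num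
  have hdcomp : ∀ (f : ℝ[X]) (n : ℕ), f.degree < n → (f.comp (X + C (ρ 1))).degree < n := by
    intro f n hf
    rw [← mem_degreeLT] at hf ⊢
    exact taylor_mem_degreeLT.2 hf
  have heq := heq (by
      rw [degree_C_mul (Real.rpow_pos_of_pos ha0 _).ne']
      exact hdcomp _ _ (degree_divX_lt hdp))
    (hdcomp _ _ (degree_divX_lt hdq)) (by
      intro j hj
      have hj0 : ρ (j + 1) ≠ 0 := by
        rw [← h0]
        exact (hρ (by omega : 0 < j + 1)).ne'
      have e₁ := h₁.eval_eq (j + 1) (by omega)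
      have e₂ := h₂.eval_eq (j + 1) (by omega)
      have e₃ := eval_divX (p₁ - p₂) (ρ (j + 1))
      have e₄ := eval_divX (q₁ - q₂) (ρ (j + 1))
      rw [hp0, eval_sub, add_zero] at e₃
      rw [hq0, eval_sub, add_zero] at e₄
      have e₅ : a ^ (ρ (j + 1) - ρ 1) * a ^ ρ 1 = a ^ ρ (j + 1) := by
        rw [← Real.rpow_add ha0]
        simp
      simp only [eval_mul, eval_C, eval_comp, eval_add, eval_X, sub_add_cancel]
      refine mul_left_cancel₀ hj0 ?_
      rw [← mul_assoc (a ^ _), e₅]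
      linear_combination e₁ - e₂ - a ^ ρ (j + 1) * e₃ + e₄)
  set κ := ((q₁ - q₂).divX.comp (X + C (ρ 1))).eval 0
  have hfin : q₁ - q₂ = X * (C κ * q'.comp (X - C (ρ 1))) := by
    have h3 := congrArg (fun f : ℝ[X] => f.comp (X - C (ρ 1))) heq
    simp only [comp_assoc, add_comp, X_comp, C_comp, sub_add_cancel, comp_X, mul_comp] at h3
    rw [← h3]
    conv_lhs => rw [← X_mul_divX_add (q₁ - q₂), coeff_zero_eq_eval_zero, hq0]
    simp
  refine ⟨κ, ?_, hfin⟩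
  -- Only `q₂` reaches degree `l + 1`, so the known signs of the top coefficients of `q₂` and `q'`
  -- force `κ > 0`.
  have hc := congrArg (fun f : ℝ[X] => f.coeff (l + 1)) hfin
  have hq'l : q'.coeff l ≠ 0 := right_ne_zero_of_mul hlead.ne'
  have hnd : q'.natDegree = l := by
    refine le_antisymm ?_ (le_natDegree_of_ne_zero hq'l)
    exact Nat.lt_succ_iff.1 ((natDegree_lt_iff_degree_lt (by
      rintro h; rw [h] at hq'l; simp at hq'l)).2 h'.degree_num)
  have htay : (q'.comp (X - C (ρ 1))).coeff l = q'.coeff l := by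
    have := coeff_taylor_natDegree (r := -ρ 1) (f := q')
    rw [hnd, taylor_apply, C_neg, ← sub_eq_add_neg, leadingCoeff, hnd] at this
    exact this
  simp only [coeff_X_mul, coeff_C_mul, coeff_sub, htay] at hc
  rw [(degree_lt_iff_coeff_zero q₁ (l + 1)).1 h₁.degree_num (l + 1) le_rfl, zero_sub] at hc
  have h6 : (-1) ^ (l + 1) * q₂.coeff (l + 1) = κ * ((-1) ^ l * q'.coeff l) := by
    rw [pow_succ]
    linear_combination (-1) ^ l * hc
  rw [h6] at hlead₂
  exact pos_of_mul_pos_left hlead₂ hlead.le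

end

open Polynomial in
theorem exists_eq_X_sub_C_mul {p : ℝ[X]} {n : ℕ} {c : ℝ} (hp : p.degree < (n + 1 : ℕ))
    (hc : p.eval c = 0) : ∃ g : ℝ[X], g.degree < n ∧ p = (X - C c) * g := by
  obtain ⟨g, rfl⟩ := dvd_iff_isRoot.2 hc
  refine ⟨g, ?_, rfl⟩
  by_cases hg : g = 0
  · simp [hg]
  · rw [degree_mul, degree_X_sub_C, degree_eq_natDegree hg] at hp
    rw [degree_eq_natDegree hg]
    norm_cast at hp ⊢
    omega

/-! ### Monotonicity, Lipschitz bounds and corner cutting -/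

section

variable {a : ℝ} {ρ : ℕ → ℝ}

theorem padeNum_eval_zero (ha0 : 0 < a) (ha1 : a < 1) (h0 : ρ 0 = 0) (hρ : StrictMono ρ)
    (k l : ℕ) : (padeNum a ρ k l).eval 0 = 1 :=
  (exists_isPadePair_padeNum ha0 ha1 h0 hρ k l).choose_spec.eval_zero

theorem padeNum_right_zero (ha0 : 0 < a) (ha1 : a < 1) (h0 : ρ 0 = 0) (hρ : StrictMono ρ)
    (k : ℕ) : padeNum a ρ k 0 = 1 := by
  obtain ⟨p, h⟩ := exists_isPadePair_padeNum ha0 ha1 h0 hρ k 0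
  rw [Polynomial.eq_C_of_degree_le_zero (p := padeNum a ρ k 0) (by
    rw [← Nat.WithBot.lt_one_iff_le_zero]; simpa using h.degree_num)]
  rw [Polynomial.coeff_zero_eq_eval_zero, h.eval_zero, Polynomial.C_1]

theorem padeNum_left_zero_eval (ha0 : 0 < a) (ha1 : a < 1) (h0 : ρ 0 = 0) (hρ : StrictMono ρ)
    {l j : ℕ} (hj : j ≤ l) : (padeNum a ρ 0 l).eval (ρ j) = a ^ ρ j := by
  obtain ⟨p, h⟩ := exists_isPadePair_padeNum ha0 ha1 h0 hρ 0 l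
  have hp := Polynomial.eq_C_of_degree_le_zero (p := p) (by
    rw [← Nat.WithBot.lt_one_iff_le_zero]; simpa using h.degree_den)
  have h1 := h.eval_eq 0 (by omega)
  rw [h0, h.eval_zero, hp] at h1
  have h2 := h.eval_eq j (by omega)
  rw [hp] at h2
  simp at h1 h2
  rw [← h2, h1, mul_one]

/-- Consecutive control point functionals on `t ^ ρ j`. -/
theorem padeNum_eval_sub (ha0 : 0 < a) (ha1 : a < 1) (h0 : ρ 0 = 0) (hρ : StrictMono ρ)
    (k l : ℕ) : ∃ κ > 0, ∀ z, (padeNum a ρ (k + 1) l).eval z - (padeNum a ρ k (l + 1)).eval z =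
      κ * z * (padeNum a (fun j => ρ (j + 1) - ρ 1) k l).eval (z - ρ 1) := by
  obtain ⟨κ, hκ, h⟩ := padeNum_sub_padeNum ha0 ha1 h0 hρ k l
  refine ⟨κ, hκ, fun z => ?_⟩
  rw [← Polynomial.eval_sub, h]
  simp
  ring

/-- By induction on `N` the shifted numerators are nonnegative at their nodes. The difference
formula then makes the values increase with `k`, from `a ^ ρ j` at `k = 0` to `1` at `l = 0`. -/
theorem padeNum_eval_mem_Icc (ha0 : 0 < a) (ha1 : a < 1) (N : ℕ) : ∀ {ρ : ℕ → ℝ} (_ : ρ 0 = 0)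
    (_ : StrictMono ρ) (k l : ℕ) (_ : k + l = N) (j : ℕ) (_ : j ≤ N),
    (padeNum a ρ k l).eval (ρ j) ∈ Icc (a ^ ρ j) 1 := by
  induction N with
  | zero =>
    intro ρ h0 hρ k l hkl j hj
    obtain rfl : l = 0 := by omega
    obtain rfl : j = 0 := by omega
    rw [padeNum_right_zero ha0 ha1 h0 hρ, h0]
    simp
  | succ N ih =>
    intro ρ h0 hρ
    have mono : ∀ k l, k + l = N → ∀ j ≤ N + 1,
        (padeNum a ρ k (l + 1)).eval (ρ j) ≤ (padeNum a ρ (k + 1) l).eval (ρ j) := by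
      intro k l hkl j hj
      obtain ⟨κ, hκ, h⟩ := padeNum_eval_sub ha0 ha1 h0 hρ k l
      rw [← sub_nonneg, h]
      cases j with
      | zero => simp [h0]
      | succ j =>
        have h1 := (ih (by simp) (strictMono_shift hρ) k l hkl j (by omega)).1
        have h2 : 0 < ρ (j + 1) := by rw [← h0]; exact hρ (by omega)
        exact mul_nonneg (by positivity) ((Real.rpow_pos_of_pos ha0 _).le.trans h1)
    intro k l hkl j hj
    constructor
    · induction k generalizing l with
      | zero => rw [padeNum_left_zero_eval ha0 ha1 h0 hρ (by omega)]
      | succ k ihk => exact (ihk (l + 1) (by omega)).trans (mono k l (by omega) j hj)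
    · induction l generalizing k with
      | zero => rw [padeNum_right_zero ha0 ha1 h0 hρ]; simp
      | succ l ihl => exact (mono k l (by omega) j hj).trans (ihl (k + 1) (by omega))

theorem padeNum_eval_pos (ha0 : 0 < a) (ha1 : a < 1) (h0 : ρ 0 = 0) (hρ : StrictMono ρ)
    {k l j : ℕ} (hj : j ≤ k + l) : 0 < (padeNum a ρ k l).eval (ρ j) :=
  (Real.rpow_pos_of_pos ha0 _).trans_le
    (padeNum_eval_mem_Icc ha0 ha1 (k + l) h0 hρ k l rfl j hj).1

/-- In `κ z q'(z - ρ 1)` the factor `q'` equals `1` at `z = ρ 1` and lies in `[0, 1]` at the later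
nodes. -/
theorem padeNum_eval_step (ha0 : 0 < a) (ha1 : a < 1) (h0 : ρ 0 = 0) (hρ : StrictMono ρ)
    (k l j : ℕ) (hj : j ≤ k + l + 1) :
    0 ≤ (padeNum a ρ (k + 1) l).eval (ρ j) - (padeNum a ρ k (l + 1)).eval (ρ j) ∧
    (padeNum a ρ (k + 1) l).eval (ρ j) - (padeNum a ρ k (l + 1)).eval (ρ j) ≤ ρ j / ρ 1 *
      ((padeNum a ρ (k + 1) l).eval (ρ 1) - (padeNum a ρ k (l + 1)).eval (ρ 1)) := by
  obtain ⟨κ, hκ, h⟩ := padeNum_eval_sub ha0 ha1 h0 hρ k l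
  have h1 : 0 < ρ 1 := by rw [← h0]; exact hρ (by omega)
  rw [h, h, sub_self, padeNum_eval_zero ha0 ha1 (by simp) (strictMono_shift hρ)]
  cases j with
  | zero => simp [h0]
  | succ j =>
    have h2 : 0 < ρ (j + 1) := by rw [← h0]; exact hρ (by omega)
    have h3 := padeNum_eval_mem_Icc ha0 ha1 (k + l) (ρ := fun j => ρ (j + 1) - ρ 1) (by simp)
      (strictMono_shift hρ) k l rfl j (by omega)
    have h4 := (Real.rpow_pos_of_pos ha0 _).le.trans h3.1
    refine ⟨mul_nonneg (by positivity) h4, ?_⟩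
    have h5 : ρ (j + 1) / ρ 1 * (κ * ρ 1 * 1) = κ * ρ (j + 1) := by field_simp
    rw [h5]
    exact mul_le_of_le_one_right (by positivity) h3.2

/-- All one-step increments are nonnegative, so telescoping loses nothing. -/
theorem padeNum_eval_lipschitz_aux (ha0 : 0 < a) (ha1 : a < 1) (h0 : ρ 0 = 0) (hρ : StrictMono ρ)
    (d : ℕ) : ∀ (k l j : ℕ) (_ : j ≤ k + l + d),
    0 ≤ (padeNum a ρ (k + d) l).eval (ρ j) - (padeNum a ρ k (l + d)).eval (ρ j) ∧
    (padeNum a ρ (k + d) l).eval (ρ j) - (padeNum a ρ k (l + d)).eval (ρ j) ≤ ρ j / ρ 1 *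
      ((padeNum a ρ (k + d) l).eval (ρ 1) - (padeNum a ρ k (l + d)).eval (ρ 1)) := by
  induction d with
  | zero => intro k l j _; simp
  | succ d ih =>
    intro k l j hj
    obtain ⟨h1, h2⟩ := ih k (l + 1) j (by omega)
    obtain ⟨h3, h4⟩ := padeNum_eval_step ha0 ha1 h0 hρ (k + d) l j (by omega)
    rw [show l + 1 + d = l + (d + 1) by ring] at h1 h2
    rw [show k + d + 1 = k + (d + 1) by ring] at h3 h4
    constructor
    · linarith
    · linarith

theorem padeNum_eval_lipschitz (ha0 : 0 < a) (ha1 : a < 1) (h0 : ρ 0 = 0) (hρ : StrictMono ρ)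
    {m i i' j : ℕ} (hi : i ≤ m) (hi' : i' ≤ m) (hj : j ≤ m) :
    |(padeNum a ρ i (m - i)).eval (ρ j) - (padeNum a ρ i' (m - i')).eval (ρ j)| ≤ ρ j / ρ 1 *
      |(padeNum a ρ i (m - i)).eval (ρ 1) - (padeNum a ρ i' (m - i')).eval (ρ 1)| := by
  wlog h : i' ≤ i generalizing i i'
  · rw [abs_sub_comm, abs_sub_comm (Polynomial.eval (ρ 1) _)]
    exact this hi' hi (by omega)
  have hj0 : 0 ≤ ρ j / ρ 1 := by
    have h1 : 0 < ρ 1 := by rw [← h0]; exact hρ (by omega)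
    have h2 : 0 ≤ ρ j := by rw [← h0]; exact hρ.monotone (by omega)
    positivity
  obtain ⟨h1, h2⟩ := padeNum_eval_lipschitz_aux ha0 ha1 h0 hρ (i - i') i' (m - i) j (by omega)
  rw [show i' + (i - i') = i by omega, show m - i + (i - i') = m - i' by omega] at h1 h2
  rw [abs_of_nonneg h1]
  exact h2.trans (mul_le_mul_of_nonneg_left (le_abs_self _) hj0)

open Polynomial in
/-- Corner cutting: the relation between control point functionals of consecutive degrees. -/
theorem padeNum_corner_cutting (ha0 : 0 < a) (ha1 : a < 1) (h0 : ρ 0 = 0) (hρ : StrictMono ρ)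
    (k l : ℕ) : ∃ τ ∈ Icc (0 : ℝ) 1, ∀ z, (padeNum a ρ k (l + 1)).eval z =
      (1 - τ) * ((1 - z / ρ (k + l + 1)) * (padeNum a ρ k l).eval z) +
        τ * (padeNum a ρ (k + 1) l).eval z := by
  obtain ⟨p₁, h₁⟩ := exists_isPadePair_padeNum ha0 ha1 h0 hρ (k + 1) l
  obtain ⟨p₂, h₂⟩ := exists_isPadePair_padeNum ha0 ha1 h0 hρ k (l + 1)
  have hpos₁ := padeNum_eval_pos ha0 ha1 h0 hρ (k := k + 1) (l := l) (j := k + l + 1) (by omega)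
  have hpos₂ := padeNum_eval_pos ha0 ha1 h0 hρ (k := k) (l := l + 1) (j := k + l + 1) (by omega)
  have hle := sub_nonneg.1 (padeNum_eval_step ha0 ha1 h0 hρ k l (k + l + 1) le_rfl).1
  set q₁ := padeNum a ρ (k + 1) l
  set q₂ := padeNum a ρ k (l + 1)
  set R := ρ (k + l + 1)
  have hR : 0 < R := by rw [← h0]; exact hρ (by omega)
  -- This `τ` makes `q₂ - τ q₁`, and with it `p₂ - τ p₁`, vanish at the last node. Removing the
  -- factor `z - R` leaves a pair for the earlier nodes; monotonicity gives `τ ≤ 1`.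
  set τ := q₂.eval R / q₁.eval R
  have hτ : τ * q₁.eval R = q₂.eval R := div_mul_cancel₀ _ hpos₁.ne'
  have hlt : ∀ n : ℕ, ((n + 1 : ℕ) : WithBot ℕ) < (n + 1 + 1 : ℕ) := fun n => by
    exact_mod_cast Nat.lt_succ_self _
  obtain ⟨g, hg, hgq⟩ := exists_eq_X_sub_C_mul (p := q₂ - C τ * q₁) (n := l + 1) (c := R)
    (degree_sub_lt_of_lt h₂.degree_num (degree_C_mul_lt _ (h₁.degree_num.trans (hlt l))))
    (by rw [eval_sub, eval_mul, eval_C, hτ, sub_self])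
  obtain ⟨f, hf, hfp⟩ := exists_eq_X_sub_C_mul (p := p₂ - C τ * p₁) (n := k + 1) (c := R)
    (degree_sub_lt_of_lt (h₂.degree_den.trans (hlt k)) (degree_C_mul_lt _ h₁.degree_den)) (by
      refine (mul_eq_zero.1 ?_).resolve_left (Real.rpow_pos_of_pos ha0 R).ne'
      have e₁ := h₁.eval_eq (k + l + 1) (by omega)
      have e₂ := h₂.eval_eq (k + l + 1) (by omega)
      rw [eval_sub, eval_mul, eval_C]
      linear_combination e₂ - τ * e₁ - hτ)
  have key := eq_C_mul_padeNum ha0 ha1 h0 hρ hf hg (by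
    intro j hj
    have hjR : ρ j - R ≠ 0 := sub_ne_zero.2 (hρ (by omega : j < k + l + 1)).ne
    have e₁ := h₁.eval_eq j (by omega)
    have e₂ := h₂.eval_eq j (by omega)
    have e₃ := congrArg (eval (ρ j)) hgq
    have e₄ := congrArg (eval (ρ j)) hfp
    simp only [eval_sub, eval_mul, eval_C, eval_X] at e₃ e₄
    refine mul_left_cancel₀ hjR ?_
    linear_combination e₂ - τ * e₁ + e₃ - a ^ ρ j * e₄)
  have hg0 : 1 - τ = -R * g.eval 0 := by
    have := congrArg (eval 0) hgq
    simpa [h₁.eval_zero, h₂.eval_zero] using this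
  refine ⟨τ, ⟨by positivity, (div_le_one hpos₁).2 hle⟩, fun z => ?_⟩
  have e₁ := congrArg (eval z) hgq
  have e₂ := congrArg (eval z) key
  simp only [eval_sub, eval_mul, eval_C, eval_X] at e₁ e₂
  rw [e₂] at e₁
  rw [hg0]
  field_simp
  linear_combination e₁

/-- A control point functional over `[a, 1]` is a convex combination of those over `[0, 1]`. -/
theorem exists_padeNum_eq_convex_combination (ha0 : 0 < a) (ha1 : a < 1) (h0 : ρ 0 = 0)
    (hρ : StrictMono ρ) (N : ℕ) : ∀ (l k : ℕ) (_ : k + l = N), ∃ c : ℕ → ℝ, (∀ i, 0 ≤ c i) ∧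
      ∑ i ∈ Finset.range (N + 1), c i = 1 ∧ ∀ j ≤ N, (padeNum a ρ k l).eval (ρ j) =
        ∑ i ∈ Finset.range (N + 1), c i * ∏ s ∈ Finset.Ioc i N, (1 - ρ j / ρ s) := by
  classical
  have base : ∀ N k, ∃ c : ℕ → ℝ, (∀ i, 0 ≤ c i) ∧
      ∑ i ∈ Finset.range (N + 1), c i = 1 ∧ ∀ j ≤ N, (padeNum a ρ k 0).eval (ρ j) =
        ∑ i ∈ Finset.range (N + 1), c i * ∏ s ∈ Finset.Ioc i N, (1 - ρ j / ρ s) := by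
    intro N k
    refine ⟨fun i => if i = N then 1 else 0, fun i => by positivity, by simp, fun j _ => ?_⟩
    rw [padeNum_right_zero ha0 ha1 h0 hρ]
    simp
  induction N with
  | zero =>
    intro l k hkl
    obtain rfl : l = 0 := by omega
    exact base 0 k
  | succ N ih =>
    intro l
    induction l with
    | zero => exact fun k _ => base (N + 1) k
    | succ l ihl =>
      intro k hkl
      obtain ⟨τ, ⟨hτ0, hτ1⟩, hτ⟩ := padeNum_corner_cutting ha0 ha1 h0 hρ k l
      obtain ⟨c, hc0, hc1, hc⟩ := ih l k (by omega)
      obtain ⟨c', hc0', hc1', hc'⟩ := ihl (k + 1) (by omega)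
      rw [show k + l + 1 = N + 1 by omega] at hτ
      refine ⟨fun i => (1 - τ) * (if i ≤ N then c i else 0) + τ * c' i, ?_, ?_, ?_⟩
      · intro i
        have : 0 ≤ if i ≤ N then c i else 0 := by
          split_ifs
          exacts [hc0 i, le_rfl]
        exact add_nonneg (mul_nonneg (by linarith) this) (mul_nonneg hτ0 (hc0' i))
      · rw [Finset.sum_add_distrib, ← Finset.mul_sum, ← Finset.mul_sum, hc1',
          Finset.sum_range_succ, Finset.sum_congr rfl (fun i hi => if_pos (by
            rw [Finset.mem_range] at hi; omega)), hc1]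
        simp
      · intro j hj
        have h1 : (1 - ρ j / ρ (N + 1)) * (padeNum a ρ k l).eval (ρ j) =
            ∑ i ∈ Finset.range (N + 1 + 1), (if i ≤ N then c i else 0) *
              ∏ s ∈ Finset.Ioc i (N + 1), (1 - ρ j / ρ s) := by
          rw [Finset.sum_range_succ, if_neg (by omega), zero_mul, add_zero]
          have h2 : ∀ i ∈ Finset.range (N + 1), (if i ≤ N then c i else 0) *
              ∏ s ∈ Finset.Ioc i (N + 1), (1 - ρ j / ρ s) = (1 - ρ j / ρ (N + 1)) *
              (c i * ∏ s ∈ Finset.Ioc i N, (1 - ρ j / ρ s)) := by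
            intro i hi
            rw [Finset.mem_range] at hi
            rw [if_pos (by omega), Finset.prod_Ioc_succ_top (by omega)]
            ring
          rw [Finset.sum_congr rfl h2, ← Finset.mul_sum]
          -- The induction hypothesis does not cover the new node, but there the factor `1 - ρ j / ρ
          -- (N + 1)` is zero.
          rcases hj.eq_or_lt with rfl | hj
          · have : 0 < ρ (N + 1) := by rw [← h0]; exact hρ (by omega)
            rw [div_self this.ne', sub_self, zero_mul, zero_mul]
          · rw [hc j (by omega)]
        rw [hτ, h1, hc' j hj, Finset.mul_sum, Finset.mul_sum, ← Finset.sum_add_distrib]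
        refine Finset.sum_congr rfl fun i _ => ?_
        ring

end

/-! ### Asymptotics over `[0, 1]` and approximation of powers -/

/-- Each factor lies between `exp (-(1 + 2δ) x)` and `exp (-x)`. The bound does not depend on the
number of factors because `S exp (-S) ≤ 1`. -/
theorem abs_prod_one_sub_sub_exp_le {ι : Type*} (T : Finset ι) {x : ι → ℝ} {δ : ℝ}
    (hδ0 : 0 ≤ δ) (hδ : δ ≤ 1 / 2)
    (hx : ∀ s ∈ T, x s ∈ Icc 0 δ) : |∏ s ∈ T, (1 - x s) - Real.exp (-∑ s ∈ T, x s)| ≤ 2 * δ := by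
  set S := ∑ s ∈ T, x s
  have hS : 0 ≤ S := Finset.sum_nonneg fun s hs => (hx s hs).1
  have hup : ∏ s ∈ T, (1 - x s) ≤ Real.exp (-S) := by
    rw [← Finset.sum_neg_distrib, Real.exp_sum]
    refine Finset.prod_le_prod (fun s hs => ?_) fun s _ => ?_
    · linarith [(hx s hs).2]
    · linarith [Real.add_one_le_exp (-x s)]
  have hlo : Real.exp (-S) * Real.exp (-(2 * δ * S)) ≤ ∏ s ∈ T, (1 - x s) := by
    rw [← Real.exp_add, show -S + -(2 * δ * S) = ∑ s ∈ T, (-(1 + 2 * δ) * x s) by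
      rw [← Finset.mul_sum]; ring, Real.exp_sum]
    refine Finset.prod_le_prod (fun s _ => (Real.exp_pos _).le) fun s hs => ?_
    obtain ⟨h0, h1⟩ := hx s hs
    have h2 : 0 < 1 - x s := by linarith
    have h3 := Real.add_one_le_exp ((1 + 2 * δ) * x s)
    have h4 : 1 ≤ (1 - x s) * ((1 + 2 * δ) * x s + 1) := by
      nlinarith [mul_nonneg h0 (sub_nonneg.2 h1), mul_nonneg h0 hδ0,
        mul_nonneg (mul_nonneg h0 hδ0) (by linarith : 0 ≤ 1 - 2 * x s)]
    rw [neg_mul, Real.exp_neg, inv_le_comm₀ (Real.exp_pos _) h2]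
    refine le_trans ?_ h3
    rw [inv_le_iff_one_le_mul₀ h2]
    linarith
  have hSe : S * Real.exp (-S) ≤ 1 := by
    rw [Real.exp_neg, ← div_eq_mul_inv, div_le_one (Real.exp_pos _)]
    linarith [Real.add_one_le_exp S]
  rw [abs_le]
  constructor
  · have h5 := Real.add_one_le_exp (-(2 * δ * S))
    have h6 := mul_le_mul_of_nonneg_left h5 (Real.exp_pos (-S)).le
    nlinarith [mul_le_mul_of_nonneg_left hSe hδ0]
  · linarith

/-- At an interior extremum the derivative vanishes, and the hypothesis reads `ρ |h| ≤ M`. -/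
theorem abs_le_of_abs_mul_deriv_sub_le {h h' : ℝ → ℝ} {ρ M : ℝ} (hρ : 0 < ρ) (hM : 0 ≤ M)
    (hc : ContinuousOn h (Icc 0 1)) (h0 : h 0 = 0) (h1 : h 1 = 0)
    (hd : ∀ x ∈ Ioo (0 : ℝ) 1, HasDerivAt h (h' x) x)
    (hb : ∀ x ∈ Ioo (0 : ℝ) 1, |x * h' x - ρ * h x| ≤ M) :
    ∀ x ∈ Icc (0 : ℝ) 1, |h x| ≤ M / ρ := by
  have key : ∀ {h h' : ℝ → ℝ}, ContinuousOn h (Icc 0 1) → h 0 = 0 → h 1 = 0 →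
      (∀ x ∈ Ioo (0 : ℝ) 1, HasDerivAt h (h' x) x) →
      (∀ x ∈ Ioo (0 : ℝ) 1, |x * h' x - ρ * h x| ≤ M) → ∀ x ∈ Icc (0 : ℝ) 1, h x ≤ M / ρ := by
    intro h h' hc h0 h1 hd hb x hx
    obtain ⟨y, hy, hmax⟩ := isCompact_Icc.exists_isMaxOn ⟨x, hx⟩ hc
    refine (hmax hx).trans ?_
    have hM' : 0 ≤ M / ρ := by positivity
    rcases hy.1.eq_or_lt with rfl | hy0
    · rwa [h0]
    rcases hy.2.eq_or_lt with rfl | hy1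
    · rwa [h1]
    have hz := (hmax.isLocalMax (Icc_mem_nhds hy0 hy1)).hasDerivAt_eq_zero (hd y ⟨hy0, hy1⟩)
    have := hb y ⟨hy0, hy1⟩
    rw [hz, mul_zero, zero_sub, abs_neg] at this
    rw [le_div_iff₀ hρ]
    linarith [le_abs_self (ρ * h y)]
  intro x hx
  rw [abs_le]
  constructor
  · have := key (h := fun x => -h x) (h' := fun x => -h' x) hc.neg (by simp [h0]) (by simp [h1])
      (fun x hx => (hd x hx).neg) (fun x hx => by
        rw [← abs_neg]
        refine le_of_eq_of_le ?_ (hb x hx)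
        congr 1
        ring) x hx
    linarith
  · exact key hc h0 h1 hd hb x hx

section

variable {r : ℕ → ℝ}

/-- Von Golitschek's explicit approximation of `x ^ y` from a Müntz space. -/
theorem exists_abs_rpow_sub_sum_le (h0 : r 0 = 0) (hr : StrictMono r) {y : ℝ} (hy : 0 < y)
    (N : ℕ) : ∃ d : ℕ → ℝ, ∀ x ∈ Icc (0 : ℝ) 1,
      |x ^ y - ∑ j ∈ Finset.Ioc 0 N, d j * x ^ r j| ≤ |∏ s ∈ Finset.Ioc 0 N, (1 - y / r s)| := by
  have hpos : ∀ j, 0 < j → 0 < r j := fun j hj => by rw [← h0]; exact hr hj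
  induction N with
  | zero =>
    refine ⟨0, fun x hx => ?_⟩
    simp only [Finset.Ioc_self, Finset.sum_empty, Finset.prod_empty, sub_zero, abs_one]
    rw [abs_of_nonneg (Real.rpow_nonneg hx.1 _)]
    exact Real.rpow_le_one hx.1 hx.2 hy.le
  | succ N ih =>
    obtain ⟨d, hd⟩ := ih
    set ρ := r (N + 1)
    have hρ : 0 < ρ := hpos _ (by omega)
    -- With these coefficients the operator `x d/dx - ρ` sends the new error to `-(ρ - y)` times the
    -- old one. It kills `x ^ ρ`, so `b` is free to make the new error vanish at `1`.
    let e : ℕ → ℝ := fun j => d j * (ρ - y) / (ρ - r j)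
    let b := 1 - ∑ j ∈ Finset.Ioc 0 N, e j
    let f : ℕ → ℝ := fun j => if j = N + 1 then b else e j
    let h : ℝ → ℝ := fun x => x ^ y - ∑ j ∈ Finset.Ioc 0 N, e j * x ^ r j - b * x ^ ρ
    have hfh : ∀ x, x ^ y - ∑ j ∈ Finset.Ioc 0 (N + 1), f j * x ^ r j = h x := by
      intro x
      rw [Finset.sum_Ioc_succ_top (by omega)]
      have : ∑ j ∈ Finset.Ioc 0 N, f j * x ^ r j = ∑ j ∈ Finset.Ioc 0 N, e j * x ^ r j := by
        refine Finset.sum_congr rfl fun j hj => ?_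
        rw [Finset.mem_Ioc] at hj
        rw [show f j = e j from if_neg (by omega)]
      rw [this, show f (N + 1) = b from if_pos rfl, ← sub_sub]
    refine ⟨f, fun x hx => ?_⟩
    rw [hfh, Finset.prod_Ioc_succ_top (by omega), abs_mul]
    have hM : |∏ s ∈ Finset.Ioc 0 N, (1 - y / r s)| * |1 - y / ρ| =
        |ρ - y| * |∏ s ∈ Finset.Ioc 0 N, (1 - y / r s)| / ρ := by
      rw [show 1 - y / ρ = (ρ - y) / ρ by field_simp, abs_div, abs_of_pos hρ]
      ring
    rw [hM]
    refine abs_le_of_abs_mul_deriv_sub_le (h := h) (h' := fun x => y * x ^ (y - 1) -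
      ∑ j ∈ Finset.Ioc 0 N, e j * (r j * x ^ (r j - 1)) - b * (ρ * x ^ (ρ - 1)))
      hρ (by positivity) ?_ ?_ ?_ ?_ ?_ x hx
    · refine Continuous.continuousOn ?_
      refine ((Real.continuous_rpow_const hy.le).sub (continuous_finsetSum _ fun j hj => ?_)).sub
        ((Real.continuous_rpow_const hρ.le).const_mul _)
      exact (Real.continuous_rpow_const (hpos j (Finset.mem_Ioc.1 hj).1).le).const_mul _
    · simp only [h]
      rw [Real.zero_rpow hy.ne', Real.zero_rpow hρ.ne', Finset.sum_eq_zero]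
      · simp
      · intro j hj
        rw [Real.zero_rpow (hpos j (Finset.mem_Ioc.1 hj).1).ne', mul_zero]
    · simp [h, b]
    · intro x hx
      have hx0 : x ≠ 0 := hx.1.ne'
      refine ((Real.hasDerivAt_rpow_const (Or.inl hx0)).fun_sub
        (HasDerivAt.fun_sum fun j _ => ?_)).fun_sub
        ((Real.hasDerivAt_rpow_const (Or.inl hx0)).const_mul b)
      exact (Real.hasDerivAt_rpow_const (Or.inl hx0)).const_mul (e j)
    · intro x hx
      have hmul : ∀ t : ℝ, x * (t * x ^ (t - 1)) = t * x ^ t := by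
        intro t
        rw [Real.rpow_sub_one hx.1.ne']
        field_simp [hx.1.ne']
      have hid : x * (y * x ^ (y - 1) - ∑ j ∈ Finset.Ioc 0 N, e j * (r j * x ^ (r j - 1)) -
          b * (ρ * x ^ (ρ - 1))) - ρ * h x =
          -((ρ - y) * (x ^ y - ∑ j ∈ Finset.Ioc 0 N, d j * x ^ r j)) := by
        have h3 : x * ∑ j ∈ Finset.Ioc 0 N, e j * (r j * x ^ (r j - 1)) -
            ρ * ∑ j ∈ Finset.Ioc 0 N, e j * x ^ r j =
            -((ρ - y) * ∑ j ∈ Finset.Ioc 0 N, d j * x ^ r j) := by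
          rw [Finset.mul_sum, Finset.mul_sum, Finset.mul_sum, ← Finset.sum_sub_distrib,
            ← Finset.sum_neg_distrib]
          refine Finset.sum_congr rfl fun j hj => ?_
          have h4 : ρ - r j ≠ 0 := sub_ne_zero.2
            (hr (by have := (Finset.mem_Ioc.1 hj).2; omega : j < N + 1)).ne'
          rw [mul_left_comm, hmul]
          simp only [e]
          field_simp
          ring
        simp only [h]
        linear_combination hmul y - b * hmul ρ - h3
      rw [hid, abs_neg, abs_mul]
      exact mul_le_mul_of_nonneg_left (hd x ⟨hx.1.le, hx.2.le⟩) (abs_nonneg _)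

theorem tendsto_sum_Ioc (hMuntz : Tendsto (fun N : ℕ => ∑ i ∈ Finset.Icc 1 N, 1 / r i) atTop atTop)
    (L : ℕ) : Tendsto (fun m => ∑ s ∈ Finset.Ioc L m, 1 / r s) atTop atTop := by
  have h1 := tendsto_atTop_add_const_right atTop (-∑ s ∈ Finset.Ioc 0 L, 1 / r s) hMuntz
  refine h1.congr' ?_
  filter_upwards [eventually_ge_atTop L] with m hm
  have h2 := Finset.sum_Ioc_consecutive (fun s => 1 / r s) (Nat.zero_le L) hm
  have h3 : Finset.Icc 1 m = Finset.Ioc 0 m := by ext; simp; omega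
  rw [h3, ← h2]
  ring

/-- Under the Müntz condition the control points of `t ^ z` over `[0, 1]` are asymptotically
`z`-th powers. -/
theorem eventually_abs_prod_sub_exp_le (h0 : r 0 = 0) (hr : StrictMono r)
    (hlim : Tendsto r atTop atTop)
    (hMuntz : Tendsto (fun N : ℕ => ∑ i ∈ Finset.Icc 1 N, 1 / r i) atTop atTop)
    {z : ℝ} (hz : 0 < z) {ε : ℝ} (hε : 0 < ε) :
    ∀ᶠ m in atTop, ∀ i ≤ m, |∏ s ∈ Finset.Ioc i m, (1 - z / r s) -
      Real.exp (-(z * ∑ s ∈ Finset.Ioc i m, 1 / r s))| ≤ ε := by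
  have hpos : ∀ j, 0 < j → 0 < r j := fun j hj => by rw [← h0]; exact hr hj
  obtain ⟨δ, hδ0, hδ1, hδε⟩ : ∃ δ : ℝ, 0 < δ ∧ δ ≤ 1 / 2 ∧ 2 * δ ≤ ε :=
    ⟨min (1 / 2) (ε / 2), by positivity, min_le_left _ _, by
      linarith [min_le_right (1 / 2) (ε / 2)]⟩
  obtain ⟨L, hL⟩ := eventually_atTop.1 (hlim.eventually_ge_atTop (z / δ))
  have hx : ∀ s, L ≤ s → 0 < s → z / r s ∈ Icc 0 δ := by
    intro s hs hs0
    refine ⟨(div_pos hz (hpos s hs0)).le, ?_⟩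
    rw [div_le_comm₀ (hpos s hs0) hδ0]
    exact hL s hs
  have hlarge : ∀ i m, L ≤ i → |∏ s ∈ Finset.Ioc i m, (1 - z / r s) -
      Real.exp (-(z * ∑ s ∈ Finset.Ioc i m, 1 / r s))| ≤ 2 * δ := by
    intro i m hi
    have := abs_prod_one_sub_sub_exp_le (Finset.Ioc i m) (x := fun s => z / r s) hδ0.le hδ1
      (fun s hs => hx s (by rw [Finset.mem_Ioc] at hs; omega)
        (by rw [Finset.mem_Ioc] at hs; omega))
    rw [Finset.mul_sum]
    simpa [div_eq_mul_inv] using this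
  -- For `i < L` the factors before `L` may be large or negative, but they contribute at most `K`.
  -- The product and the exponential beyond `L` both tend to zero.
  set K := ∑ i ∈ Finset.range L, |∏ s ∈ Finset.Ioc i L, (1 - z / r s)|
  have hK : 0 ≤ K := Finset.sum_nonneg fun _ _ => abs_nonneg _
  have hexp : Tendsto (fun m => (K + 1) * Real.exp (-(z * ∑ s ∈ Finset.Ioc L m, 1 / r s))) atTop
      (𝓝 0) := by
    rw [← mul_zero (K + 1)]
    refine Tendsto.const_mul _ (Real.tendsto_exp_neg_atTop_nhds_zero.comp ?_)
    exact (tendsto_sum_Ioc hMuntz L).const_mul_atTop hz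
  filter_upwards [hexp.eventually_le_const hε, eventually_ge_atTop L] with m hm hLm i hi
  rcases le_or_gt L i with h | h
  · exact (hlarge i m h).trans hδε
  · refine le_trans ?_ hm
    set E := Real.exp (-(z * ∑ s ∈ Finset.Ioc L m, 1 / r s))
    have hprod : |∏ s ∈ Finset.Ioc L m, (1 - z / r s)| ≤ E := by
      have hxs : ∀ s ∈ Finset.Ioc L m, z / r s ∈ Icc 0 δ := fun s hs =>
        hx s (by rw [Finset.mem_Ioc] at hs; omega) (by rw [Finset.mem_Ioc] at hs; omega)
      rw [abs_of_nonneg (Finset.prod_nonneg fun s hs => by linarith [(hxs s hs).2])]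
      simp only [E]
      rw [Finset.mul_sum, ← Finset.sum_neg_distrib, Real.exp_sum]
      refine Finset.prod_le_prod (fun s hs => by linarith [(hxs s hs).2]) fun s _ => ?_
      have := Real.add_one_le_exp (-(z * (1 / r s)))
      rw [mul_one_div] at this ⊢
      linarith
    have h1 : |∏ s ∈ Finset.Ioc i L, (1 - z / r s)| ≤ K :=
      Finset.single_le_sum (f := fun i => |∏ s ∈ Finset.Ioc i L, (1 - z / r s)|)
        (fun _ _ => abs_nonneg _) (Finset.mem_range.2 h)
    have h2 : Real.exp (-(z * ∑ s ∈ Finset.Ioc i m, 1 / r s)) ≤ E := by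
      refine Real.exp_le_exp.2 (neg_le_neg (mul_le_mul_of_nonneg_left ?_ hz.le))
      refine Finset.sum_le_sum_of_subset_of_nonneg (Finset.Ioc_subset_Ioc_left h.le)
        fun s hs _ => ?_
      have := hpos s (by rw [Finset.mem_Ioc] at hs; omega)
      positivity
    rw [← Finset.prod_Ioc_consecutive _ h.le hLm]
    refine (abs_sub _ _).trans ?_
    rw [abs_mul, Real.abs_exp]
    have h3 := mul_le_mul h1 hprod (abs_nonneg _) hK
    linarith

end

section

variable {r : ℕ → ℝ}

/-- Under the Müntz condition `x ^ y` is a uniform limit of elements of the Müntz space without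
constant term. -/
theorem exists_abs_rpow_sub_sum_le_of_muntz (h0 : r 0 = 0) (hr : StrictMono r)
    (hlim : Tendsto r atTop atTop)
    (hMuntz : Tendsto (fun N : ℕ => ∑ i ∈ Finset.Icc 1 N, 1 / r i) atTop atTop)
    {y : ℝ} (hy : 0 < y) {ε : ℝ} (hε : 0 < ε) :
    ∃ (n : ℕ) (d : ℕ → ℝ), ∀ x ∈ Icc (0 : ℝ) 1,
      |x ^ y - ∑ j ∈ Finset.Ioc 0 n, d j * x ^ r j| ≤ ε := by
  have h1 := eventually_abs_prod_sub_exp_le h0 hr hlim hMuntz hy (half_pos hε)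
  have h2 : Tendsto (fun m => Real.exp (-(y * ∑ s ∈ Finset.Ioc 0 m, 1 / r s))) atTop (𝓝 0) :=
    Real.tendsto_exp_neg_atTop_nhds_zero.comp ((tendsto_sum_Ioc hMuntz 0).const_mul_atTop hy)
  obtain ⟨n, hn1, hn2⟩ := (h1.and (h2.eventually_le_const (half_pos hε))).exists
  obtain ⟨d, hd⟩ := exists_abs_rpow_sub_sum_le h0 hr hy n
  refine ⟨n, d, fun x hx => (hd x hx).trans ?_⟩
  have h3 := abs_le.1 (hn1 0 (Nat.zero_le n))
  have h4 := Real.exp_pos (-(y * ∑ s ∈ Finset.Ioc 0 n, 1 / r s))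
  rw [abs_le]
  constructor <;> linarith [h3.1, h3.2]

/-- The squares of the control points of `t ^ r 1` over `[0, 1]` are asymptotically bounded by
the control points of an approximation of `t ^ (2 * r 1)`. -/
theorem exists_eventually_prod_sq_le (h0 : r 0 = 0) (hr : StrictMono r)
    (hlim : Tendsto r atTop atTop)
    (hMuntz : Tendsto (fun N : ℕ => ∑ i ∈ Finset.Icc 1 N, 1 / r i) atTop atTop)
    {ε : ℝ} (hε : 0 < ε) :
    ∃ (n : ℕ) (d : ℕ → ℝ), (∀ x ∈ Icc (0 : ℝ) 1,
        ∑ j ∈ Finset.Ioc 0 n, d j * x ^ r j ≤ (x ^ r 1) ^ 2 + ε) ∧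
      ∀ᶠ m in atTop, ∀ i ≤ m, (∏ s ∈ Finset.Ioc i m, (1 - r 1 / r s)) ^ 2 ≤
        ∑ j ∈ Finset.Ioc 0 n, d j * ∏ s ∈ Finset.Ioc i m, (1 - r j / r s) + ε := by
  have hpos : ∀ j, 0 < j → 0 < r j := fun j hj => by rw [← h0]; exact hr hj
  have h1 : 0 < r 1 := hpos 1 one_pos
  have hsq : ∀ x : ℝ, 0 ≤ x → x ^ (2 * r 1) = (x ^ r 1) ^ 2 := by
    intro x hx
    rw [mul_comm, Real.rpow_mul hx, ← Real.rpow_natCast]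
    norm_num
  obtain ⟨n, d, hd⟩ := exists_abs_rpow_sub_sum_le_of_muntz h0 hr hlim hMuntz
    (y := 2 * r 1) (by positivity) (half_pos hε)
  refine ⟨n, d, fun x hx => ?_, ?_⟩
  · have := abs_le.1 (hd x hx)
    rw [hsq x hx.1] at this
    linarith [this.1]
  set D := ∑ j ∈ Finset.Ioc 0 n, |d j|
  have hD : 0 ≤ D := Finset.sum_nonneg fun _ _ => abs_nonneg _
  -- Squaring in `[0, 1]` costs `2 η` and replacing powers by products costs `D η`. The other `ε /
  -- 2` pays for the approximation of `x ^ (2 r 1)`.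
  set η := ε / (2 * (D + 2))
  have hη : 0 < η := by positivity
  have hηD : 2 * η + D * η = ε / 2 := by
    simp only [η]
    field_simp
    ring
  have hev : ∀ᶠ m in atTop, ∀ j ∈ Finset.Ioc 0 n, ∀ i ≤ m,
      |∏ s ∈ Finset.Ioc i m, (1 - r j / r s) -
        Real.exp (-(r j * ∑ s ∈ Finset.Ioc i m, 1 / r s))| ≤ η :=
    (Finset.eventually_all _).2 fun j hj => eventually_abs_prod_sub_exp_le h0 hr hlim hMuntz
      (hpos j (Finset.mem_Ioc.1 hj).1) hη
  filter_upwards [hev, eventually_abs_prod_sub_exp_le h0 hr hlim hMuntz h1 hη] with m hm hm1 i hi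
  -- One `x` serves all exponents: the product for `t ^ z` is close to `x ^ z`.
  set x := Real.exp (-∑ s ∈ Finset.Ioc i m, 1 / r s)
  have hxpow : ∀ z, Real.exp (-(z * ∑ s ∈ Finset.Ioc i m, 1 / r s)) = x ^ z := by
    intro z
    rw [← Real.exp_mul]
    ring_nf
  have hx0 : 0 < x := Real.exp_pos _
  have hx1 : x ≤ 1 := by
    refine Real.exp_le_one_iff.2 (neg_nonpos.2 (Finset.sum_nonneg fun s hs => ?_))
    have := hpos s (by rw [Finset.mem_Ioc] at hs; omega)
    positivity
  have hfac : ∀ s ∈ Finset.Ioc i m, 1 - r 1 / r s ∈ Icc (0 : ℝ) 1 := by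
    intro s hs
    rw [Finset.mem_Ioc] at hs
    have h2 := hpos s (by omega)
    have h3 : r 1 / r s ≤ 1 := (div_le_one h2).2 (hr.monotone (by omega))
    have h4 : 0 ≤ r 1 / r s := by positivity
    exact ⟨by linarith, by linarith⟩
  set p := ∏ s ∈ Finset.Ioc i m, (1 - r 1 / r s)
  have hp0 : 0 ≤ p := Finset.prod_nonneg fun s hs => (hfac s hs).1
  have hp1 : p ≤ 1 := Finset.prod_le_one (fun s hs => (hfac s hs).1) fun s hs => (hfac s hs).2
  have hpx := abs_le.1 (hm1 i hi)
  rw [hxpow] at hpx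
  have hy0 : 0 ≤ x ^ r 1 := Real.rpow_nonneg hx0.le _
  have hy1 : x ^ r 1 ≤ 1 := Real.rpow_le_one hx0.le hx1 h1.le
  have hp2 : p ^ 2 ≤ (x ^ r 1) ^ 2 + 2 * η := by
    nlinarith [hpx.2, mul_le_mul_of_nonneg_right (sub_nonneg.2 hpx.2) (add_nonneg hp0 hy0)]
  have hsum : ∑ j ∈ Finset.Ioc 0 n, d j * x ^ r j ≤
      ∑ j ∈ Finset.Ioc 0 n, d j * ∏ s ∈ Finset.Ioc i m, (1 - r j / r s) + D * η := by
    simp only [D]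
    rw [Finset.sum_mul, ← Finset.sum_add_distrib]
    refine Finset.sum_le_sum fun j hj => ?_
    have h5 := hm j hj i hi
    rw [hxpow] at h5
    have h6 := mul_le_mul_of_nonneg_left h5 (abs_nonneg (d j))
    rw [← abs_mul, abs_le] at h6
    linarith [h6.1]
  have := (abs_le.1 (hd x ⟨hx0.le, hx1⟩)).2
  rw [hsq x hx0.le] at this
  linarith

/-- The convex weights are the same for every `j`, so Jensen's inequality for the square transfers
the estimate from `[0, 1]` to `[a, 1]`. -/
theorem exists_eventually_padeNum_sq_le (h0 : r 0 = 0) (hr : StrictMono r)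
    (hlim : Tendsto r atTop atTop)
    (hMuntz : Tendsto (fun N : ℕ => ∑ i ∈ Finset.Icc 1 N, 1 / r i) atTop atTop)
    {a : ℝ} (ha0 : 0 < a) (ha1 : a < 1) {ε : ℝ} (hε : 0 < ε) :
    ∃ (n : ℕ) (d : ℕ → ℝ), (∀ x ∈ Icc (0 : ℝ) 1,
        ∑ j ∈ Finset.Ioc 0 n, d j * x ^ r j ≤ (x ^ r 1) ^ 2 + ε) ∧
      ∀ᶠ m in atTop, n ≤ m ∧ ∀ i ≤ m, (padeNum a r i (m - i)).eval (r 1) ^ 2 ≤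
        ∑ j ∈ Finset.Ioc 0 n, d j * (padeNum a r i (m - i)).eval (r j) + ε := by
  obtain ⟨n, d, hd, hev⟩ := exists_eventually_prod_sq_le h0 hr hlim hMuntz hε
  refine ⟨n, d, hd, ?_⟩
  filter_upwards [hev, eventually_ge_atTop n, eventually_ge_atTop 1] with m hm hnm h1m
  refine ⟨hnm, fun i hi => ?_⟩
  obtain ⟨c, hc0, hc1, hc⟩ :=
    exists_padeNum_eq_convex_combination ha0 ha1 h0 hr m (m - i) i (by omega)
  have hjensen := (even_two.convexOn_pow (𝕜 := ℝ)).map_sum_le (t := Finset.range (m + 1)) (w := c)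
    (p := fun i => ∏ s ∈ Finset.Ioc i m, (1 - r 1 / r s)) (fun i _ => hc0 i) hc1
    (fun _ _ => mem_univ _)
  simp only [smul_eq_mul] at hjensen
  rw [hc 1 h1m]
  refine hjensen.trans ?_
  have hsum : ∑ j ∈ Finset.Ioc 0 n, d j * (padeNum a r i (m - i)).eval (r j) =
      ∑ i ∈ Finset.range (m + 1), c i *
        ∑ j ∈ Finset.Ioc 0 n, d j * ∏ s ∈ Finset.Ioc i m, (1 - r j / r s) := by
    simp_rw [Finset.mul_sum]
    rw [Finset.sum_comm]
    refine Finset.sum_congr rfl fun j hj => ?_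
    rw [Finset.mem_Ioc] at hj
    rw [hc j (by omega), Finset.mul_sum]
    refine Finset.sum_congr rfl fun i _ => ?_
    ring
  calc ∑ i ∈ Finset.range (m + 1), c i * (∏ s ∈ Finset.Ioc i m, (1 - r 1 / r s)) ^ 2
      ≤ ∑ i ∈ Finset.range (m + 1), c i *
        (∑ j ∈ Finset.Ioc 0 n, d j * ∏ s ∈ Finset.Ioc i m, (1 - r j / r s) + ε) :=
        Finset.sum_le_sum fun i hi' => mul_le_mul_of_nonneg_left
          (hm i (by rw [Finset.mem_range] at hi'; omega)) (hc0 i)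
    _ = _ := by
      simp_rw [mul_add]
      rw [Finset.sum_add_distrib, ← Finset.sum_mul, hc1, one_mul, hsum]

end

/-! ### Duality between numerators and Chebyshev–Bernstein bases -/

/-- The element `∑ c j * t ^ r j` of the Müntz space with coefficients `c`. -/
noncomputable def muntzCombination (r : ℕ → ℝ) (m : ℕ) : (Fin (m + 1) → ℝ) →ₗ[ℝ] (ℝ → ℝ) :=
  Fintype.linearCombination ℝ fun (j : Fin (m + 1)) (t : ℝ) => t ^ r j

theorem muntzCombination_apply (r : ℕ → ℝ) (m : ℕ) (c : Fin (m + 1) → ℝ) (t : ℝ) :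
    muntzCombination r m c t = ∑ j, c j * t ^ r j := by
  simp [muntzCombination, Fintype.linearCombination_apply]

theorem muntzCombination_single_zero {r : ℕ → ℝ} (h0 : r 0 = 0) (m : ℕ) (t : ℝ) :
    muntzCombination r m (Pi.single 0 1) t = 1 := by
  rw [muntzCombination_apply, Finset.sum_eq_single 0 (fun j _ hj => by simp [hj]) (by simp)]
  simp [h0]

theorem range_muntzCombination (r : ℕ → ℝ) (m : ℕ) :
    LinearMap.range (muntzCombination r m) = muntzSpace r m :=
  Fintype.range_linearCombination _ _

theorem iteratedDeriv_muntzCombination (r : ℕ → ℝ) (m : ℕ) (c : Fin (m + 1) → ℝ) (i : ℕ) :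
    ∀ {t : ℝ} (_ : 0 < t), iteratedDeriv i (muntzCombination r m c) t =
      ∑ j, c j * ((descPochhammer ℝ i).eval (r j) * t ^ (r j - i)) := by
  intro t ht
  have h1 : (muntzCombination r m c) = fun t => ∑ j, c j * t ^ r j :=
    funext (muntzCombination_apply r m c)
  have h2 : ∀ j ∈ (Finset.univ : Finset (Fin (m + 1))),
      ContDiffAt ℝ i (fun t => c j * t ^ r j) t := fun j _ =>
    contDiffAt_const.mul (contDiffAt_id.rpow_const_of_ne ht.ne')
  rw [h1, iteratedDeriv_fun_sum h2]
  refine Finset.sum_congr rfl fun j _ => ?_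
  rw [iteratedDeriv_const_mul_field, iteratedDeriv_eq_iterate, Real.iter_deriv_rpow_const]

/-- The functional `p ↦ ∑ c j * x ^ r j * p (r j)`. -/
noncomputable def muntzPairing (r : ℕ → ℝ) (m : ℕ) (c : Fin (m + 1) → ℝ) (x : ℝ) :
    Polynomial ℝ →ₗ[ℝ] ℝ :=
  ∑ j, (c j * x ^ r j) • Polynomial.leval (r j)

theorem muntzPairing_apply (r : ℕ → ℝ) (m : ℕ) (c : Fin (m + 1) → ℝ) (x : ℝ) (p : Polynomial ℝ) :
    muntzPairing r m c x p = ∑ j, c j * (x ^ r j * p.eval (r j)) := by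
  simp [muntzPairing, Polynomial.leval_apply, mul_assoc]

-- Leading terms are eliminated one at a time. The triangular families used are the falling
-- factorials, the denominators and the numerators.
open Polynomial in
theorem linearMap_eq_zero_of_degree_lt (φ : ℝ[X] →ₗ[ℝ] ℝ) (e : ℕ → ℝ[X]) (K : ℕ) :
    (∀ i < K, (e i).degree < (i + 1 : ℕ) ∧ (e i).coeff i ≠ 0 ∧ φ (e i) = 0) →
    ∀ p : ℝ[X], p.degree < K → φ p = 0 := by
  induction K with
  | zero =>
    intro _ p hp
    have : p = 0 := by simpa using hp
    rw [this, map_zero]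
  | succ K ih =>
    intro h p hp
    obtain ⟨h1, h2, h3⟩ := h K (by omega)
    have h4 : φ (p - (p.coeff K / (e K).coeff K) • e K) = 0 := by
      refine ih (fun i hi => h i (by omega)) _ ?_
      rw [degree_lt_iff_coeff_zero] at hp h1 ⊢
      intro n hn
      rcases hn.eq_or_lt with rfl | hn
      · simp [h2]
      · simp [hp n (by omega), h1 n (by omega)]
    simpa [h3] using h4

/-- The `i`-th derivative of `t ^ z` carries the falling factorial of `z` of degree `i`, and those
of degree below `K` span the polynomials of degree below `K`. -/
theorem vanishesToOrder_iff {r : ℕ → ℝ} {m : ℕ} {c : Fin (m + 1) → ℝ} {K : ℕ} {x : ℝ}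
    (hx : 0 < x) : VanishesToOrder (muntzCombination r m c) K x ↔
      ∀ p : Polynomial ℝ, p.degree < K → muntzPairing r m c x p = 0 := by
  have key : ∀ i : ℕ, iteratedDeriv i (muntzCombination r m c) x =
      muntzPairing r m c x (descPochhammer ℝ i) / x ^ i := by
    intro i
    rw [iteratedDeriv_muntzCombination r m c i hx, muntzPairing_apply, Finset.sum_div]
    refine Finset.sum_congr rfl fun j _ => ?_
    rw [Real.rpow_sub_natCast hx.ne']
    ring
  have hdeg : ∀ i, (descPochhammer ℝ i).degree = i := fun i => by
    rw [Polynomial.degree_eq_natDegree (monic_descPochhammer ℝ i).ne_zero,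
      descPochhammer_natDegree]
  constructor
  · intro h
    refine linearMap_eq_zero_of_degree_lt _ (descPochhammer ℝ) K fun i hi => ⟨?_, ?_, ?_⟩
    · rw [hdeg]
      exact_mod_cast Nat.lt_succ_self i
    · have := monic_descPochhammer ℝ i
      rw [Polynomial.Monic, Polynomial.leadingCoeff, descPochhammer_natDegree] at this
      rw [this]
      exact one_ne_zero
    · have := h i hi
      rw [key, div_eq_zero_iff] at this
      exact this.resolve_right (pow_pos hx i).ne'
  · intro h i hi
    rw [key, h _ (by rw [hdeg]; exact_mod_cast hi), zero_div]

section

variable {a : ℝ} {r : ℕ → ℝ}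

/-- The substitution `t = exp z` gives an exponential polynomial with constant coefficients; `m + 1`
zeros suffice. -/
theorem eq_of_eqOn_muntzCombination (ha0 : 0 < a) (ha1 : a < 1) (hr : StrictMono r) {m : ℕ}
    {c d : Fin (m + 1) → ℝ}
    (h : ∀ t ∈ Icc a 1, muntzCombination r m c t = muntzCombination r m d t) : c = d := by
  classical
  have hinj : Function.Injective fun j : Fin (m + 1) => r j :=
    fun i j hij => Fin.ext (hr.injective hij)
  obtain ⟨T, hT, hTc⟩ := (Set.Icc_infinite (Real.log_neg ha0 ha1)).exists_subset_card_eq (m + 1)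
  have key := exp_polynomial_eq_zero (m + 1) (Finset.univ.image fun j : Fin (m + 1) => r j)
    (fun _ => 1) (fun s => Polynomial.C (∑ j : Fin (m + 1), if r j = s then c j - d j else 0)) T
    (by simp [Finset.card_image_of_injective _ hinj])
    (fun s _ => Polynomial.degree_C_lt) (by
      intro z hz
      rw [Finset.sum_image hinj.injOn]
      have h1 := h (Real.exp z) (by
        have := hT hz
        exact ⟨(Real.log_le_iff_le_exp ha0).1 this.1, Real.exp_le_one_iff.2 this.2⟩)
      rw [← sub_eq_zero, muntzCombination_apply, muntzCombination_apply,
        ← Finset.sum_sub_distrib] at h1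
      refine Eq.trans (Finset.sum_congr rfl fun i _ => ?_) h1
      have h2 : (∑ j : Fin (m + 1), if r j = r i then c j - d j else 0) = c i - d i := by
        rw [Finset.sum_eq_single i (fun j _ hj => if_neg fun h => hj (hinj h)) (by simp),
          if_pos rfl]
      rw [Polynomial.eval_C, h2, ← Real.exp_mul]
      ring_nf) hTc.ge
  ext i
  have h3 := key (r i) (Finset.mem_image_of_mem _ (Finset.mem_univ i))
  rw [Polynomial.C_eq_zero, Finset.sum_eq_single i
    (fun j _ hj => if_neg fun h => hj (hinj h)) (by simp), if_pos rfl] at h3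
  exact sub_eq_zero.1 h3

/-- The control points of `∑ c j * t ^ r j` in terms of the coefficients `c`. -/
noncomputable def controlMap (a : ℝ) (r : ℕ → ℝ) (m : ℕ) :
    (Fin (m + 1) → ℝ) →ₗ[ℝ] (Fin (m + 1) → ℝ) :=
  LinearMap.pi fun i => (LinearMap.lsum ℝ (fun _ => ℝ) ℝ) fun j =>
    LinearMap.mulRight ℝ ((padeNum a r i (m - i)).eval (r j))

theorem controlMap_apply (a : ℝ) (r : ℕ → ℝ) (m : ℕ) (c : Fin (m + 1) → ℝ) (i : Fin (m + 1)) :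
    controlMap a r m c i = ∑ j : Fin (m + 1), c j * (padeNum a r i (m - i)).eval (r j) := by
  simp [controlMap]

theorem controlMap_eq_pairing_one (a : ℝ) (r : ℕ → ℝ) (m : ℕ) (c : Fin (m + 1) → ℝ)
    (i : Fin (m + 1)) : controlMap a r m c i = muntzPairing r m c 1 (padeNum a r i (m - i)) := by
  simp [controlMap_apply, muntzPairing_apply]

/-- The interpolation conditions turn a functional of the jet at `1`, given by the numerator, into
one of the jet at `a`, given by the denominator. -/
theorem exists_den_controlMap (ha0 : 0 < a) (ha1 : a < 1) (h0 : r 0 = 0) (hr : StrictMono r)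
    (m : ℕ) : ∃ e : ℕ → Polynomial ℝ, (∀ i, (e i).degree < (i + 1 : ℕ) ∧ (e i).coeff i ≠ 0) ∧
      ∀ (c : Fin (m + 1) → ℝ) (i : Fin (m + 1)), controlMap a r m c i =
        muntzPairing r m c a (e i) := by
  choose e he using fun i => exists_isPadePair_padeNum ha0 ha1 h0 hr i (m - i)
  refine ⟨e, fun i => ⟨(he i).degree_den, (he i).coeff_den_ne_zero ha0 ha1 hr⟩, fun c i => ?_⟩
  rw [controlMap_apply, muntzPairing_apply]
  refine Finset.sum_congr rfl fun j _ => ?_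
  rw [(he i).eval_eq j (by omega)]

theorem controlMap_injective (ha0 : 0 < a) (ha1 : a < 1) (h0 : r 0 = 0) (hr : StrictMono r)
    (m : ℕ) : Function.Injective (controlMap a r m) := by
  rw [injective_iff_map_eq_zero]
  intro c hc
  obtain ⟨e, he, hec⟩ := exists_den_controlMap ha0 ha1 h0 hr m
  have h1 := linearMap_eq_zero_of_degree_lt (muntzPairing r m c a) e (m + 1) fun i hi =>
    ⟨(he i).1, (he i).2, by rw [← hec c ⟨i, hi⟩, hc]; rfl⟩
  -- Testing against the polynomial with `a ^ r j p(r j) = c j` yields `∑ c j ^ 2 = 0`.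
  obtain ⟨p, q, hp, hq, hpq⟩ := exists_interpolates ha0 ha1 (k := m + 1) (l := 0)
    (ν := fun j : Fin (m + 1) => r j) (fun i j hij => Fin.ext (hr.injective hij)) rfl c
  have hq0 : q = 0 := by simpa using hq
  have h2 := h1 p hp
  rw [muntzPairing_apply] at h2
  have h3 : ∑ j, c j * c j = 0 := by
    rw [← h2]
    refine Finset.sum_congr rfl fun j _ => ?_
    conv_lhs => rw [← hpq j, hq0]
    rw [hpq j |>.symm, hq0]
    simp
  ext j
  exact mul_self_eq_zero.1 ((Finset.sum_eq_zero_iff_of_nonneg fun j _ => mul_self_nonneg _).1 h3 j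
    (Finset.mem_univ j))

/-- The coefficients of a curve as a function of its control points. -/
noncomputable def controlEquiv (ha0 : 0 < a) (ha1 : a < 1) (h0 : r 0 = 0) (hr : StrictMono r)
    (m : ℕ) : (Fin (m + 1) → ℝ) ≃ₗ[ℝ] (Fin (m + 1) → ℝ) :=
  LinearEquiv.ofInjectiveEndo (controlMap a r m) (controlMap_injective ha0 ha1 h0 hr m)

theorem controlMap_single_zero (ha0 : 0 < a) (ha1 : a < 1) (h0 : r 0 = 0) (hr : StrictMono r)
    (m : ℕ) : controlMap a r m (Pi.single 0 1) = 1 := by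
  ext i
  rw [controlMap_apply, Finset.sum_eq_single 0 (fun j _ hj => by simp [hj]) (by simp)]
  simp [h0, padeNum_eval_zero ha0 ha1 h0 hr]

/-- Coefficients of the Chebyshev–Bernstein basis. -/
noncomputable def bernsteinCoeff (ha0 : 0 < a) (ha1 : a < 1) (h0 : r 0 = 0) (hr : StrictMono r)
    (m : ℕ) (k : Fin (m + 1)) : Fin (m + 1) → ℝ :=
  (controlEquiv ha0 ha1 h0 hr m).symm (Pi.single k 1)

theorem controlMap_bernsteinCoeff (ha0 : 0 < a) (ha1 : a < 1) (h0 : r 0 = 0) (hr : StrictMono r)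
    (m : ℕ) (k : Fin (m + 1)) :
    controlMap a r m (bernsteinCoeff ha0 ha1 h0 hr m k) = Pi.single k 1 :=
  (controlEquiv ha0 ha1 h0 hr m).apply_symm_apply _

theorem sum_controlMap_smul (ha0 : 0 < a) (ha1 : a < 1) (h0 : r 0 = 0) (hr : StrictMono r)
    {m : ℕ} {b : Fin (m + 1) → Fin (m + 1) → ℝ}
    (hb : ∀ k, controlMap a r m (b k) = Pi.single k 1) (c : Fin (m + 1) → ℝ) :
    ∑ k, controlMap a r m c k • b k = c := by
  refine controlMap_injective ha0 ha1 h0 hr m ?_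
  rw [map_sum]
  ext i
  simp [hb, Finset.sum_apply, Pi.single_apply]

theorem sum_mul_controlMap (ha0 : 0 < a) (ha1 : a < 1) (h0 : r 0 = 0) (hr : StrictMono r)
    {m : ℕ} {b : Fin (m + 1) → Fin (m + 1) → ℝ}
    (hb : ∀ k, controlMap a r m (b k) = Pi.single k 1) (c : Fin (m + 1) → ℝ) (t : ℝ) :
    ∑ k, muntzCombination r m (b k) t * controlMap a r m c k = muntzCombination r m c t := by
  conv_rhs => rw [← sum_controlMap_smul ha0 ha1 h0 hr hb c]
  simp [map_sum, mul_comm]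

theorem vanishesToOrder_left (ha0 : 0 < a) (ha1 : a < 1) (h0 : r 0 = 0) (hr : StrictMono r)
    {m : ℕ} {c : Fin (m + 1) → ℝ} {k : Fin (m + 1)} (hc : controlMap a r m c = Pi.single k 1) :
    VanishesToOrder (muntzCombination r m c) k a := by
  obtain ⟨e, he, hec⟩ := exists_den_controlMap ha0 ha1 h0 hr m
  refine (vanishesToOrder_iff ha0).2 (linearMap_eq_zero_of_degree_lt _ e k fun i hi =>
    ⟨(he i).1, (he i).2, ?_⟩)
  have hne : (⟨i, by omega⟩ : Fin (m + 1)) ≠ k := fun h => by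
    have := congrArg Fin.val h
    simp at this
    omega
  have := hec c ⟨i, by omega⟩
  rw [hc, Pi.single_eq_of_ne hne] at this
  exact this.symm

theorem vanishesToOrder_right (ha0 : 0 < a) (ha1 : a < 1) (h0 : r 0 = 0) (hr : StrictMono r)
    {m : ℕ} {c : Fin (m + 1) → ℝ} {k : Fin (m + 1)} (hc : controlMap a r m c = Pi.single k 1) :
    VanishesToOrder (muntzCombination r m c) (m - k) 1 := by
  refine (vanishesToOrder_iff one_pos).2 (linearMap_eq_zero_of_degree_lt _
    (fun i => padeNum a r (m - i) i) (m - k) fun i hi => ⟨?_, ?_, ?_⟩)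
  · obtain ⟨p, h⟩ := exists_isPadePair_padeNum ha0 ha1 h0 hr (m - i) i
    exact h.degree_num
  · exact right_ne_zero_of_mul (padeNum_coeff_sign ha0 ha1 h0 hr (m - i) i).ne'
  · have hne : (⟨m - i, by omega⟩ : Fin (m + 1)) ≠ k := fun h => by
      have := congrArg Fin.val h
      simp at this
      omega
    have := controlMap_eq_pairing_one a r m c ⟨m - i, by omega⟩
    rw [hc, Pi.single_eq_of_ne hne] at this
    simp only [show m - (m - i) = i by omega] at this
    exact this.symm

theorem sum_muntzCombination_eq_one (ha0 : 0 < a) (ha1 : a < 1) (h0 : r 0 = 0)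
    (hr : StrictMono r) {m : ℕ} {b : Fin (m + 1) → Fin (m + 1) → ℝ}
    (hb : ∀ k, controlMap a r m (b k) = Pi.single k 1) (t : ℝ) :
    ∑ k, muntzCombination r m (b k) t = 1 := by
  have := sum_mul_controlMap ha0 ha1 h0 hr hb (Pi.single 0 1) t
  rw [controlMap_single_zero ha0 ha1 h0 hr, muntzCombination_single_zero h0] at this
  simpa using this

theorem isChebyshevBernsteinBasis_muntzCombination (ha0 : 0 < a) (ha1 : a < 1) (h0 : r 0 = 0)
    (hr : StrictMono r) (m : ℕ) : IsChebyshevBernsteinBasis r m a 1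
      fun k => muntzCombination r m (bernsteinCoeff ha0 ha1 h0 hr m k) := by
  have hb := controlMap_bernsteinCoeff ha0 ha1 h0 hr m
  have hinj : Function.Injective (muntzCombination r m) := fun c d h =>
    eq_of_eqOn_muntzCombination ha0 ha1 hr fun t _ => congrFun h t
  let B : Module.Basis (Fin (m + 1)) ℝ (Fin (m + 1) → ℝ) :=
    (Pi.basisFun ℝ (Fin (m + 1))).map (controlEquiv ha0 ha1 h0 hr m).symm
  have hB : (fun k => muntzCombination r m (bernsteinCoeff ha0 ha1 h0 hr m k)) =
      muntzCombination r m ∘ B := by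
    ext k
    simp [B, bernsteinCoeff]
  refine ⟨?_, ?_, fun t _ => sum_muntzCombination_eq_one ha0 ha1 h0 hr hb t,
    fun k => vanishesToOrder_left ha0 ha1 h0 hr (hb k),
    fun k => vanishesToOrder_right ha0 ha1 h0 hr (hb k)⟩
  · rw [hB]
    exact B.linearIndependent.map' _ (LinearMap.ker_eq_bot.2 hinj)
  · rw [hB, range_comp, ← Submodule.map_span, B.span_eq, Submodule.map_top,
      range_muntzCombination]

/-- Every Chebyshev–Bernstein basis is dual to the control point functionals. -/
theorem IsChebyshevBernsteinBasis.exists_coeff (ha0 : 0 < a) (ha1 : a < 1) (h0 : r 0 = 0)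
    (hr : StrictMono r) {m : ℕ} {B : Fin (m + 1) → ℝ → ℝ}
    (hB : IsChebyshevBernsteinBasis r m a 1 B) : ∃ b : Fin (m + 1) → Fin (m + 1) → ℝ,
      (∀ k, B k = muntzCombination r m (b k)) ∧ ∀ k, controlMap a r m (b k) = Pi.single k 1 := by
  have hmem : ∀ k, ∃ c, muntzCombination r m c = B k := by
    intro k
    have : B k ∈ LinearMap.range (muntzCombination r m) := by
      rw [range_muntzCombination, ← hB.span_eq]
      exact Submodule.subset_span (mem_range_self k)
    exact this
  choose b hb using hmem
  obtain ⟨e, he, hec⟩ := exists_den_controlMap ha0 ha1 h0 hr m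
  -- For `i < k` the zeros at `a` kill the denominator form, of degree at most `i`; for `i > k` the
  -- zeros at `1` kill the numerator form, of degree at most `m - i`. The diagonal follows since the
  -- basis sums to one.
  have hoff : ∀ i k, i ≠ k → controlMap a r m (b k) i = 0 := by
    intro i k hik
    rcases lt_or_gt_of_ne hik with h | h
    · rw [hec]
      have hz := hB.zeros_left k
      rw [← hb k] at hz
      exact (vanishesToOrder_iff ha0).1 hz _ ((he i).1.trans_le (by exact_mod_cast h))
    · rw [controlMap_eq_pairing_one]
      have hz := hB.zeros_right k
      rw [← hb k] at hz
      obtain ⟨p, hp⟩ := exists_isPadePair_padeNum ha0 ha1 h0 hr i (m - i)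
      refine (vanishesToOrder_iff one_pos).1 hz _ (hp.degree_num.trans_le ?_)
      have : (i : ℕ) > k := h
      exact_mod_cast (by omega : m - (i : ℕ) + 1 ≤ m - k)
  have hsum : ∑ k, b k = Pi.single 0 1 := by
    refine eq_of_eqOn_muntzCombination ha0 ha1 hr fun t ht => ?_
    rw [map_sum, Finset.sum_apply, muntzCombination_single_zero h0]
    simp only [hb, hB.sum_eq_one t ht]
  refine ⟨b, fun k => (hb k).symm, fun k => ?_⟩
  ext i
  rcases eq_or_ne i k with rfl | hik
  · have h1 := congrFun (controlMap_single_zero ha0 ha1 h0 hr m) i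
    rw [← hsum, map_sum, Finset.sum_apply,
      Finset.sum_eq_single i (fun j _ hj => hoff i j hj.symm) (by simp)] at h1
    simpa using h1
  · rw [hoff i k hik, Pi.single_eq_of_ne hik]

-- Interpolate `x ^ z` at the nodes by `a ^ z p + q`. The zeros at `a` kill `p`, and those at `1`
-- kill `q` up to a multiple of the numerator `Q`, on which the functional is `1`. The value at `x`
-- is thus a quotient of two top coefficients of equal sign.
open Polynomial in
theorem muntzCombination_pos (ha0 : 0 < a) (ha1 : a < 1) (h0 : r 0 = 0) (hr : StrictMono r)
    {m : ℕ} {c : Fin (m + 1) → ℝ} {k : Fin (m + 1)} (hc : controlMap a r m c = Pi.single k 1)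
    {x : ℝ} (hx : x ∈ Ioo a 1) : 0 < muntzCombination r m c x := by
  classical
  have hinj : Function.Injective fun j : Fin (m + 1) => r j :=
    fun i j hij => Fin.ext (hr.injective hij)
  obtain ⟨p, q, hp, hq, hpq⟩ := exists_interpolates ha0 ha1 (k := k) (l := m - k + 1) hinj
    (by omega) (fun j => x ^ r j)
  have hsign := coeff_sign_of_interpolates_rpow ha0 hx.1 hx.2 hp hq
    (Z := Finset.univ.image fun j : Fin (m + 1) => r j) (by
      intro z hz
      obtain ⟨j, -, rfl⟩ := Finset.mem_image.1 hz
      exact hpq j)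
    (by rw [Finset.card_image_of_injective _ hinj, Finset.card_univ, Fintype.card_fin]; omega)
  have hsign' := padeNum_coeff_sign ha0 ha1 h0 hr k (m - k)
  obtain ⟨p', hQ⟩ := exists_isPadePair_padeNum ha0 ha1 h0 hr k (m - k)
  have hval := controlMap_eq_pairing_one a r m c k
  set Q := padeNum a r k (m - k)
  set l := m - (k : ℕ)
  have hleft := (vanishesToOrder_iff ha0).1 (vanishesToOrder_left ha0 ha1 h0 hr hc) p hp
  have hright := (vanishesToOrder_iff one_pos).1 (vanishesToOrder_right ha0 ha1 h0 hr hc)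
    (q - (q.coeff l / Q.coeff l) • Q) (by
      have h1 := hQ.degree_num
      rw [degree_lt_iff_coeff_zero] at hq h1 ⊢
      intro n hn
      rcases hn.eq_or_lt with rfl | hn
      · have := right_ne_zero_of_mul hsign'.ne'
        simp [l] at this ⊢
        field_simp
        simp
      · simp [hq n (by omega), h1 n (by omega)])
  rw [map_sub, map_smul, ← hval, hc, Pi.single_eq_same, smul_eq_mul, mul_one, sub_eq_zero] at hright
  have hval' : muntzCombination r m c x = q.coeff l / Q.coeff l := by
    rw [← hright, ← zero_add (muntzPairing r m c 1 q), ← hleft, muntzPairing_apply,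
      muntzPairing_apply, muntzCombination_apply, ← Finset.sum_add_distrib]
    refine Finset.sum_congr rfl fun j _ => ?_
    rw [← hpq j, Real.one_rpow]
    ring
  rw [hval', ← mul_div_mul_left _ _ (pow_ne_zero l (by norm_num : (-1 : ℝ) ≠ 0))]
  exact div_pos hsign hsign'

theorem muntzCombination_nonneg (ha0 : 0 < a) (ha1 : a < 1) (h0 : r 0 = 0) (hr : StrictMono r)
    {m : ℕ} {c : Fin (m + 1) → ℝ} {k : Fin (m + 1)} (hc : controlMap a r m c = Pi.single k 1)
    {x : ℝ} (hx : x ∈ Icc a 1) : 0 ≤ muntzCombination r m c x := by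
  have hcont : ContinuousAt (muntzCombination r m c) x := by
    rw [show muntzCombination r m c = fun t => ∑ j, c j * t ^ r j from
      funext (muntzCombination_apply r m c)]
    exact tendsto_finsetSum _ fun j _ => tendsto_const_nhds.mul
      (Real.continuousAt_rpow_const x _ (Or.inl (ha0.trans_le hx.1).ne'))
  rw [← closure_Ioo ha1.ne] at hx
  exact ContinuousWithinAt.closure_le hx continuousWithinAt_const hcont.continuousWithinAt
    fun y hy => (muntzCombination_pos ha0 ha1 h0 hr hc hy).le

end

/-! ### Control points and concentration of the Bernstein weights -/

section

variable {a : ℝ} {r : ℕ → ℝ}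

theorem exists_eq_sum_range_of_mem_muntzSpace {n : ℕ} {f : ℝ → ℝ} (hf : f ∈ muntzSpace r n) :
    ∃ d : ℕ → ℝ, ∀ t, f t = ∑ j ∈ Finset.range (n + 1), d j * t ^ r j := by
  rw [← range_muntzCombination] at hf
  obtain ⟨c, rfl⟩ := hf
  refine ⟨fun j => if h : j < n + 1 then c ⟨j, h⟩ else 0, fun t => ?_⟩
  rw [muntzCombination_apply, ← Fin.sum_univ_eq_sum_range (fun j =>
    (if h : j < n + 1 then c ⟨j, h⟩ else 0) * t ^ r j)]
  exact Finset.sum_congr rfl fun j _ => by rw [dif_pos j.2]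

theorem sum_truncate {m n : ℕ} (hnm : n ≤ m) (d g : ℕ → ℝ) :
    ∑ j : Fin (m + 1), (if (j : ℕ) < n + 1 then d j else 0) * g j =
      ∑ j ∈ Finset.range (n + 1), d j * g j := by
  rw [Fin.sum_univ_eq_sum_range (fun j => (if j < n + 1 then d j else 0) * g j),
    ← Finset.sum_subset (Finset.range_subset_range.2 (by omega : n + 1 ≤ m + 1))]
  · exact Finset.sum_congr rfl fun j hj => by rw [if_pos (Finset.mem_range.1 hj)]
  · intro j _ hj
    rw [if_neg (by simpa using hj), zero_mul]

theorem IsChebyshevBernsteinBasis.controlMap_eq (ha0 : 0 < a) (ha1 : a < 1) (h0 : r 0 = 0)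
    (hr : StrictMono r) {m : ℕ} {B : Fin (m + 1) → ℝ → ℝ}
    (hB : IsChebyshevBernsteinBasis r m a 1 B) {c p : Fin (m + 1) → ℝ}
    (h : ∀ t ∈ Icc a 1, muntzCombination r m c t = ∑ k, B k t * p k) :
    p = controlMap a r m c := by
  obtain ⟨b, hBb, hb⟩ := hB.exists_coeff ha0 ha1 h0 hr
  have hc : c = ∑ k, p k • b k := by
    refine eq_of_eqOn_muntzCombination ha0 ha1 hr fun t ht => ?_
    rw [h t ht]
    simp [map_sum, hBb, mul_comm]
  ext i
  rw [hc, map_sum, Finset.sum_apply]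
  simp [hb, Pi.single_apply]

/-- Every Chebyshev–Bernstein basis is dual to the same functionals, so the basis chosen in the
existential is immaterial. -/
theorem isControlPolygon_iff (ha0 : 0 < a) (ha1 : a < 1) (h0 : r 0 = 0) (hr : StrictMono r)
    {m : ℕ} {f : ℝ → ℝ} {c : Fin (m + 1) → ℝ} (hf : ∀ t, f t = muntzCombination r m c t)
    (p : Fin (m + 1) → ℝ) : IsControlPolygon r m a 1 f p ↔ p = controlMap a r m c := by
  constructor
  · rintro ⟨B, hB, h⟩
    exact hB.controlMap_eq ha0 ha1 h0 hr fun t ht => by rw [← hf, h t ht]; rfl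
  · rintro rfl
    refine ⟨_, isChebyshevBernsteinBasis_muntzCombination ha0 ha1 h0 hr m, fun t _ => ?_⟩
    rw [hf, ← sum_mul_controlMap ha0 ha1 h0 hr (controlMap_bernsteinCoeff ha0 ha1 h0 hr m)]
    rfl

theorem isControlPolygon_pi_iff (ha0 : 0 < a) (ha1 : a < 1) (h0 : r 0 = 0) (hr : StrictMono r)
    {m s : ℕ} {P : ℝ → Fin s → ℝ} {c : Fin s → Fin (m + 1) → ℝ}
    (hP : ∀ t q, P t q = muntzCombination r m (c q) t) (p : Fin (m + 1) → Fin s → ℝ) :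
    IsControlPolygon r m a 1 P p ↔ p = fun i q => controlMap a r m (c q) i := by
  constructor
  · rintro ⟨B, hB, h⟩
    ext i q
    have := hB.controlMap_eq ha0 ha1 h0 hr (c := c q) (p := fun k => p k q) fun t ht => by
      rw [← hP, h t ht]
      simp [Finset.sum_apply]
    exact congrFun this i
  · rintro rfl
    refine ⟨_, isChebyshevBernsteinBasis_muntzCombination ha0 ha1 h0 hr m, fun t _ => ?_⟩
    ext q
    rw [hP, ← sum_mul_controlMap ha0 ha1 h0 hr (controlMap_bernsteinCoeff ha0 ha1 h0 hr m)]
    simp [Finset.sum_apply]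

theorem controlPoint_eq_of_forall_iff {V : Type*} [AddCommGroup V] [Module ℝ V] {m : ℕ}
    {P : ℝ → V} {p₀ : Fin (m + 1) → V} (h : ∀ p, IsControlPolygon r m a 1 P p ↔ p = p₀) :
    controlPoint r m a 1 P = p₀ := by
  have hex : ∃ p, IsControlPolygon r m a 1 P p := ⟨p₀, (h p₀).2 rfl⟩
  rw [controlPoint, dif_pos hex]
  exact (h _).1 hex.choose_spec

theorem muntzCombination_single {m j : ℕ} (hj : j ≤ m) (t : ℝ) :
    muntzCombination r m (Pi.single ⟨j, by omega⟩ 1) t = t ^ r j := by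
  rw [muntzCombination_apply, Finset.sum_eq_single (⟨j, by omega⟩ : Fin (m + 1))
    (fun i _ hi => by simp [hi]) (by simp)]
  simp

theorem controlMap_single {m j : ℕ} (hj : j ≤ m) (i : Fin (m + 1)) :
    controlMap a r m (Pi.single ⟨j, by omega⟩ 1) i = (padeNum a r i (m - i)).eval (r j) := by
  rw [controlMap_apply, Finset.sum_eq_single (⟨j, by omega⟩ : Fin (m + 1))
    (fun i _ hi => by simp [hi]) (by simp)]
  simp

theorem sum_mul_padeNum_eval (ha0 : 0 < a) (ha1 : a < 1) (h0 : r 0 = 0) (hr : StrictMono r)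
    {m j : ℕ} (hj : j ≤ m) (t : ℝ) :
    ∑ k, muntzCombination r m (bernsteinCoeff ha0 ha1 h0 hr m k) t *
      (padeNum a r k (m - k)).eval (r j) = t ^ r j := by
  rw [← muntzCombination_single hj t,
    ← sum_mul_controlMap ha0 ha1 h0 hr (controlMap_bernsteinCoeff ha0 ha1 h0 hr m)]
  exact Finset.sum_congr rfl fun k _ => by rw [controlMap_single hj]

/-- Under the Müntz condition the Chebyshev–Bernstein basis concentrates at the control points
of `t ^ r 1`. -/
theorem eventually_variance_le (ha0 : 0 < a) (ha1 : a < 1) (h0 : r 0 = 0) (hr : StrictMono r)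
    (hlim : Tendsto r atTop atTop)
    (hMuntz : Tendsto (fun N : ℕ => ∑ i ∈ Finset.Icc 1 N, 1 / r i) atTop atTop)
    {ε : ℝ} (hε : 0 < ε) : ∀ᶠ m in atTop, ∀ t ∈ Icc a 1,
      ∑ k : Fin (m + 1), muntzCombination r m (bernsteinCoeff ha0 ha1 h0 hr m k) t *
        ((padeNum a r k (m - k)).eval (r 1) - t ^ r 1) ^ 2 ≤ ε := by
  obtain ⟨n, d, hd, hev⟩ :=
    exists_eventually_padeNum_sq_le h0 hr hlim hMuntz ha0 ha1 (half_pos hε)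
  filter_upwards [hev, eventually_ge_atTop 1] with m hm h1m t ht
  have hb := controlMap_bernsteinCoeff ha0 ha1 h0 hr m
  set β : Fin (m + 1) → ℝ := fun k =>
    muntzCombination r m (bernsteinCoeff ha0 ha1 h0 hr m k) t with hβ
  have hβ0 : ∀ k, 0 ≤ β k := fun k => muntzCombination_nonneg ha0 ha1 h0 hr (hb k) ht
  have hβ1 : ∑ k, β k = 1 := sum_muntzCombination_eq_one ha0 ha1 h0 hr hb t
  have hβj : ∀ j ≤ m, ∑ k : Fin (m + 1), β k * (padeNum a r k (m - k)).eval (r j) = t ^ r j :=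
    fun j hj => sum_mul_padeNum_eval ha0 ha1 h0 hr hj t
  -- The weights have total mass one and mean `t ^ r 1`, so this is the usual variance identity.
  have hexpand : ∑ k : Fin (m + 1), β k * ((padeNum a r k (m - k)).eval (r 1) - t ^ r 1) ^ 2 =
      ∑ k : Fin (m + 1), β k * (padeNum a r k (m - k)).eval (r 1) ^ 2 - (t ^ r 1) ^ 2 := by
    have : ∀ k : Fin (m + 1), β k * ((padeNum a r k (m - k)).eval (r 1) - t ^ r 1) ^ 2 =
        β k * (padeNum a r k (m - k)).eval (r 1) ^ 2 -
          2 * t ^ r 1 * (β k * (padeNum a r k (m - k)).eval (r 1)) + (t ^ r 1) ^ 2 * β k :=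
      fun k => by ring
    rw [Finset.sum_congr rfl fun k _ => this k, Finset.sum_add_distrib, Finset.sum_sub_distrib,
      ← Finset.mul_sum, ← Finset.mul_sum, hβ1, hβj 1 h1m]
    ring
  have hbound : ∑ k : Fin (m + 1), β k * (padeNum a r k (m - k)).eval (r 1) ^ 2 ≤
      ∑ j ∈ Finset.Ioc 0 n, d j * t ^ r j + ε / 2 := by
    calc ∑ k : Fin (m + 1), β k * (padeNum a r k (m - k)).eval (r 1) ^ 2
        ≤ ∑ k : Fin (m + 1), β k * (∑ j ∈ Finset.Ioc 0 n,
            d j * (padeNum a r k (m - k)).eval (r j) + ε / 2) :=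
          Finset.sum_le_sum fun k _ =>
            mul_le_mul_of_nonneg_left (hm.2 k (by omega)) (hβ0 k)
      _ = _ := by
          simp_rw [mul_add]
          rw [Finset.sum_add_distrib, ← Finset.sum_mul, hβ1, one_mul]
          simp_rw [Finset.mul_sum]
          rw [Finset.sum_comm]
          congr 1
          refine Finset.sum_congr rfl fun j hj => ?_
          rw [← hβj j ((Finset.mem_Ioc.1 hj).2.trans hm.1), Finset.mul_sum]
          exact Finset.sum_congr rfl fun k _ => by ring
  rw [hexpand]
  linarith [hd t ⟨ha0.le.trans ht.1, ht.2⟩]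

theorem rpow_one_div_mem_Icc (ha0 : 0 < a) {u z : ℝ} (hz : 0 < z) (hu : u ∈ Icc (a ^ z) 1) :
    u ^ (1 / z) ∈ Icc a 1 ∧ (u ^ (1 / z)) ^ z = u := by
  have hu0 : 0 ≤ u := (Real.rpow_nonneg ha0.le _).trans hu.1
  have hz' : 0 ≤ 1 / z := by positivity
  refine ⟨⟨?_, Real.rpow_le_one hu0 hu.2 hz'⟩, ?_⟩
  · have := Real.rpow_le_rpow (Real.rpow_nonneg ha0.le _) hu.1 hz'
    rwa [← Real.rpow_mul ha0.le, mul_one_div_cancel hz.ne', Real.rpow_one] at this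
  · rw [← Real.rpow_mul hu0, one_div_mul_cancel hz.ne', Real.rpow_one]

/-- At the chosen `t` the mean of the control points of `t ^ r 1` is the `i`-th one. Small variance
concentrates the weights near it, and the Lipschitz bound passes this on to the exponent `r j`. -/
theorem eventually_abs_rpow_sub_padeNum_le (ha0 : 0 < a) (ha1 : a < 1) (h0 : r 0 = 0)
    (hr : StrictMono r) (hlim : Tendsto r atTop atTop)
    (hMuntz : Tendsto (fun N : ℕ => ∑ i ∈ Finset.Icc 1 N, 1 / r i) atTop atTop)
    (j : ℕ) {ε : ℝ} (hε : 0 < ε) : ∀ᶠ m in atTop, ∀ i ≤ m,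
      |((padeNum a r i (m - i)).eval (r 1) ^ (1 / r 1)) ^ r j -
        (padeNum a r i (m - i)).eval (r j)| ≤ ε := by
  have h1 : 0 < r 1 := by rw [← h0]; exact hr one_pos
  have hj0 : 0 ≤ r j := by rw [← h0]; exact hr.monotone (Nat.zero_le j)
  set C := r j / r 1
  have hC : 0 ≤ C := by positivity
  set δ := ε / (C + 1)
  have hδ : 0 < δ := by positivity
  have hCδ : C * δ ≤ ε := by
    have : (C + 1) * δ = ε := by simp only [δ]; field_simp
    linarith
  filter_upwards [eventually_variance_le ha0 ha1 h0 hr hlim hMuntz (sq_pos_of_pos hδ),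
    eventually_ge_atTop 1, eventually_ge_atTop j] with m hm h1m hjm i hi
  obtain ⟨ht, htu⟩ := rpow_one_div_mem_Icc ha0 h1
    (padeNum_eval_mem_Icc ha0 ha1 m h0 hr i (m - i) (by omega) 1 h1m)
  have hb := controlMap_bernsteinCoeff ha0 ha1 h0 hr m
  have hvar := hm _ ht
  rw [htu] at hvar
  rw [← sum_mul_padeNum_eval ha0 ha1 h0 hr hjm]
  have hβ1 := sum_muntzCombination_eq_one ha0 ha1 h0 hr hb
    ((padeNum a r i (m - i)).eval (r 1) ^ (1 / r 1))
  have hβ0 := fun k => muntzCombination_nonneg ha0 ha1 h0 hr (hb k) ht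
  set u := (padeNum a r i (m - i)).eval (r 1)
  set v := (padeNum a r i (m - i)).eval (r j) with hv
  set β : Fin (m + 1) → ℝ := fun k =>
    muntzCombination r m (bernsteinCoeff ha0 ha1 h0 hr m k) (u ^ (1 / r 1))
  have hdiff : ∑ k : Fin (m + 1), β k * (padeNum a r k (m - k)).eval (r j) - v =
      ∑ k : Fin (m + 1), β k * ((padeNum a r k (m - k)).eval (r j) - v) := by
    simp_rw [mul_sub]
    rw [Finset.sum_sub_distrib, ← Finset.sum_mul, hβ1, one_mul]
  rw [hdiff]
  calc |∑ k : Fin (m + 1), β k * ((padeNum a r k (m - k)).eval (r j) - v)|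
      ≤ ∑ k : Fin (m + 1), |β k * ((padeNum a r k (m - k)).eval (r j) - v)| :=
        Finset.abs_sum_le_sum_abs _ _
    _ ≤ ∑ k : Fin (m + 1), β k * (C *
          ((((padeNum a r k (m - k)).eval (r 1) - u) ^ 2 / δ + δ) / 2)) := by
        refine Finset.sum_le_sum fun k _ => ?_
        rw [abs_mul, abs_of_nonneg (hβ0 k)]
        refine mul_le_mul_of_nonneg_left ?_ (hβ0 k)
        refine (padeNum_eval_lipschitz ha0 ha1 h0 hr (by omega) hi hjm).trans
          (mul_le_mul_of_nonneg_left ?_ hC)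
        change |(padeNum a r k (m - k)).eval (r 1) - u| ≤ _
        -- The inequality `|w| ≤ (w ^ 2 / δ + δ) / 2` takes the place of Cauchy–Schwarz; it matches
        -- the variance bound `δ ^ 2`.
        rw [← sq_abs ((padeNum a r k (m - k)).eval (r 1) - u), le_div_iff₀ two_pos,
          div_add' _ _ _ hδ.ne', le_div_iff₀ hδ]
        nlinarith [sq_nonneg (|(padeNum a r k (m - k)).eval (r 1) - u| - δ)]
    _ = C / (2 * δ) * ∑ k : Fin (m + 1), β k * ((padeNum a r k (m - k)).eval (r 1) - u) ^ 2 +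
          C * δ / 2 * ∑ k, β k := by
        rw [Finset.mul_sum, Finset.mul_sum, ← Finset.sum_add_distrib]
        refine Finset.sum_congr rfl fun k _ => ?_
        field_simp
    _ ≤ C / (2 * δ) * δ ^ 2 + C * δ / 2 * 1 := by
        rw [hβ1]
        gcongr
    _ = C * δ := by
        field_simp
        ring
    _ ≤ ε := hCδ

end

theorem corollary1 (r : ℕ → ℝ) (hr0 : r 0 = 0) (hr : StrictMono r)
    (hlim : Tendsto r atTop atTop)
    (hMuntz : Tendsto (fun N : ℕ => ∑ i ∈ Finset.Icc 1 N, 1 / r i) atTop atTop)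
    (a : ℝ) (ha0 : 0 < a) (ha1 : a < 1) (s n : ℕ)
    (P : ℝ → Fin s → ℝ) (hP : ∀ c : Fin s, (fun t => P t c) ∈ muntzSpace r n) :
    -- the control points of `P` and of `t ^ r 1` are well defined, and those of `t ^ r 1`
    -- have their `1 / r 1`-th powers in `[a, 1]`
    (∀ m, n ≤ m → ∃! p : Fin (m + 1) → Fin s → ℝ, IsControlPolygon r m a 1 P p) ∧
    (∀ m, 1 ≤ m → ∃! q : Fin (m + 1) → ℝ, IsControlPolygon r m a 1 (fun t => t ^ r 1) q) ∧
    (∀ m, 1 ≤ m → ∀ i, controlPoint r m a 1 (fun t => t ^ r 1) i ∈ Set.Icc (a ^ r 1) 1) ∧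
    -- the convergence, in the sup norm of `ℝ ^ s` and uniformly in `i`
    Tendsto (fun m : ℕ => ⨆ i : Fin (m + 1),
        ‖P ((controlPoint r m a 1 (fun t => t ^ r 1) i) ^ (1 / r 1)) -
          controlPoint r m a 1 P i‖) atTop (𝓝 0) := by
  choose d hd using fun q => exists_eq_sum_range_of_mem_muntzSpace (hP q)
  have hcurve : ∀ m, n ≤ m → ∀ p, IsControlPolygon r m a 1 P p ↔
      p = fun (i : Fin (m + 1)) q =>
      ∑ j ∈ Finset.range (n + 1), d q j * (padeNum a r i (m - i)).eval (r j) := by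
    intro m hm p
    rw [isControlPolygon_pi_iff ha0 ha1 hr0 hr
      (c := fun q j => if (j : ℕ) < n + 1 then d q j else 0) (fun t q => by
        rw [muntzCombination_apply, sum_truncate hm (d q) (fun j => t ^ r j)]
        exact hd q t)]
    simp only [controlMap_apply]
    rw [show (fun (i : Fin (m + 1)) q => ∑ j : Fin (m + 1), (if (j : ℕ) < n + 1 then d q j else 0) *
        (padeNum a r i (m - i)).eval (r j)) = _ from funext fun i => funext fun q =>
      sum_truncate hm (d q) (fun j => (padeNum a r i (m - i)).eval (r j))]
  have hpower : ∀ m, 1 ≤ m → ∀ p, IsControlPolygon r m a 1 (fun t => t ^ r 1) p ↔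
      p = fun i : Fin (m + 1) => (padeNum a r i (m - i)).eval (r 1) := by
    intro m hm p
    rw [isControlPolygon_iff ha0 ha1 hr0 hr (fun t => (muntzCombination_single hm t).symm),
      show controlMap a r m (Pi.single ⟨1, by omega⟩ 1) = _ from
        funext fun i => controlMap_single hm i]
  refine ⟨fun m hm => ⟨_, (hcurve m hm _).2 rfl, fun p hp => (hcurve m hm p).1 hp⟩,
    fun m hm => ⟨_, (hpower m hm _).2 rfl, fun p hp => (hpower m hm p).1 hp⟩,
    fun m hm i => ?_, ?_⟩
  · rw [controlPoint_eq_of_forall_iff (hpower m hm)]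
    exact padeNum_eval_mem_Icc ha0 ha1 m hr0 hr i (m - i) (by omega) 1 hm
  · rw [Metric.tendsto_atTop']
    intro ε hε
    -- Summing over all coordinates lets a single `η` serve every component of `P`.
    set D := ∑ q, ∑ j ∈ Finset.range (n + 1), |d q j|
    have hD : 0 ≤ D := Finset.sum_nonneg fun _ _ => Finset.sum_nonneg fun _ _ => abs_nonneg _
    set η := ε / (2 * (D + 1))
    have hη : 0 < η := by positivity
    have hDη : D * η ≤ ε / 2 := by
      have : (D + 1) * η = ε / 2 := by simp only [η]; field_simp
      linarith
    have hev : ∀ᶠ m in atTop, ∀ j ∈ Finset.range (n + 1), ∀ i ≤ m,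
        |((padeNum a r i (m - i)).eval (r 1) ^ (1 / r 1)) ^ r j -
          (padeNum a r i (m - i)).eval (r j)| ≤ η :=
      (Finset.eventually_all _).2 fun j _ =>
        eventually_abs_rpow_sub_padeNum_le ha0 ha1 hr0 hr hlim hMuntz j hη
    obtain ⟨M, hM⟩ := eventually_atTop.1
      ((hev.and (eventually_ge_atTop 1)).and (eventually_ge_atTop n))
    refine ⟨M, fun m hm => ?_⟩
    obtain ⟨⟨hconv, h1m⟩, hnm⟩ := hM m hm.le
    rw [controlPoint_eq_of_forall_iff (hpower m h1m), controlPoint_eq_of_forall_iff (hcurve m hnm),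
      Real.dist_0_eq_abs, abs_of_nonneg (Real.iSup_nonneg fun _ => norm_nonneg _)]
    refine (ciSup_le fun i => ?_).trans_lt (half_lt_self hε)
    refine (pi_norm_le_iff_of_nonneg (half_pos hε).le).2 fun q => le_trans ?_ hDη
    rw [Pi.sub_apply, hd q, ← Finset.sum_sub_distrib, Real.norm_eq_abs]
    calc _ ≤ ∑ j ∈ Finset.range (n + 1), |d q j| * η := by
          refine (Finset.abs_sum_le_sum_abs _ _).trans (Finset.sum_le_sum fun j hj => ?_)
          rw [← mul_sub, abs_mul]
          exact mul_le_mul_of_nonneg_left (hconv j hj i (by omega)) (abs_nonneg _)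
      _ ≤ D * η := by
          rw [← Finset.sum_mul]
          refine mul_le_mul_of_nonneg_right ?_ hη.le
          exact Finset.single_le_sum (f := fun q => ∑ j ∈ Finset.range (n + 1), |d q j|)
            (fun _ _ => Finset.sum_nonneg fun _ _ => abs_nonneg _) (Finset.mem_univ q)
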